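/- \textbf{Definitions.} A \emph{martingale} is a function $f$ from (finite) bitstrings to non-negative reals such that $f(x) = (f(x0)+f(x1))/2$ for every bitstring $x$. An infinite bit sequence $\alpha$ is \emph{computably random} (CR) if every computable martingale is bounded on the set of all prefixes of $\alpha$; it is \emph{CR relative to} a sequence $\gamma$ if the same holds for every martingale that is computable with oracle $\gamma$. A \emph{bivariate martingale} is a function $f$ from pairs of bitstrings to non-negative reals such that, for all bitstrings $x$ and $y$, both $f(x,\cdot)$ and $f(\cdot,y)$ are martingales. A pair $(\alpha,\beta)$ of infinite bit sequences is \emph{CR} if every computable bivariate martingale is bounded on the set of all pairs $(x,y)$ with $x$ a prefix of $\alpha$ and $y$ a prefix of $\beta$. Here a real-valued function is computable (with an oracle) if some algorithm (with that oracle) computes, from an argument and $n \in \mathbb{N}$, a dyadic rational within $2^{-n}$ of the value. \textbf{Proposition.} There exists a pair $(\alpha,\beta)$ of infinite bit sequences such that the pair $(\alpha,\beta)$ is not CR, $\alpha$ is CR, and $\beta$ is CR relative to $\alpha$. -/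

import Mathlib

/-- A *martingale*: a function `f` from bitstrings to nonnegative reals with
`f x = (f (x0) + f (x1)) / 2` for every bitstring `x`. -/
structure IsMartingale (f : List Bool → ℝ) : Prop where
  nonneg : ∀ x, 0 ≤ f x
  average : ∀ x, f x = (f (x ++ [false]) + f (x ++ [true])) / 2

/-- A *bivariate martingale*: a function of two bitstrings that is a martingale in each of its
arguments when the other one is fixed. -/
def IsBivariateMartingale (f : List Bool → List Bool → ℝ) : Prop :=
  (∀ x, IsMartingale fun y => f x y) ∧ (∀ y, IsMartingale fun x => f x y)

/-- A real-valued function `f` is computable with oracles in `O` if some function computable with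
oracles in `O` maps each `x` and each `n` to a dyadic rational `(a - b) / 2 ^ n` (given by the two
natural numbers `a` and `b`) at distance at most `2 ^ (-n)` from `f x`. -/
def RealComputableIn {X : Type*} [Primcodable X] (O : Set (ℕ →. ℕ)) (f : X → ℝ) : Prop :=
  ∃ q : X × ℕ → ℕ × ℕ, ComputableIn O q ∧
    ∀ x n, |f x - (((q (x, n)).1 : ℝ) - ((q (x, n)).2 : ℝ)) / 2 ^ n| ≤ 1 / 2 ^ n

/-- A computable real-valued function (no oracle; `ComputableIn ∅` is plain computability, see
`recursiveIn_empty_iff`). -/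
def RealComputable {X : Type*} [Primcodable X] (f : X → ℝ) : Prop :=
  RealComputableIn ∅ f

/-- The bit sequence `α` as an oracle: the total function `n ↦ α n`, with `false`, `true` coded as
`0`, `1`. -/
def bitOracle (α : ℕ → Bool) : ℕ →. ℕ :=
  fun n => Part.some (α n).toNat

/-- The prefix of length `n` of the infinite bit sequence `α`. -/
def bitPrefix (α : ℕ → Bool) (n : ℕ) : List Bool :=
  (List.range n).map α

/-- `α` is *computably random*: every computable martingale is bounded on the prefixes of `α`. -/
def IsCR (α : ℕ → Bool) : Prop :=
  ∀ f : List Bool → ℝ, IsMartingale f → RealComputable f →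
    BddAbove (Set.range fun n => f (bitPrefix α n))

/-- `β` is *computably random relative to* `α`: every martingale that is computable with oracle `α`
is bounded on the prefixes of `β`. -/
def IsCRRelativeTo (β α : ℕ → Bool) : Prop :=
  ∀ f : List Bool → ℝ, IsMartingale f → RealComputableIn {bitOracle α} f →
    BddAbove (Set.range fun n => f (bitPrefix β n))

/-- The pair `(α, β)` is *computably random*: every computable bivariate martingale is bounded on
the pairs formed by a prefix of `α` and a prefix of `β` (of independent lengths). -/
def IsCRPair (α β : ℕ → Bool) : Prop :=
  ∀ f : List Bool → List Bool → ℝ, IsBivariateMartingale f →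
    RealComputable (fun p : List Bool × List Bool => f p.1 p.2) →
      BddAbove (Set.range fun k : ℕ × ℕ => f (bitPrefix α k.1) (bitPrefix β k.2))

/-! ### Computability of bounded sums, products and quantifiers -/

section Bounded

variable {A : Type*} [Primcodable A]

/-! Let `t` be the stage at which program `n` halts. For infinitely many halting `n`, the sequence
`β` is made to repeat, at positions `n` to `3n - 1`, the bits of `α` at positions `t` to `t + 2n -
1`. A bivariate martingale profits from this: it gives weight `2^(-n)` to the bet that the two
blocks agree, a bet that multiplies its stake by `2^(2n)`, so it reaches `2^n`
(`two_pow_le_copyMartingale`). It never has to decide whether `n` halts, since the bet is neutral as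
long as `x` has at most `t` bits.

Both sequences come from forcing (`Cond.exists_generic`). A condition is a finite stem with a
supermartingale that must stay below `1` on further prefixes. Any supermartingale of the class can
be added to a condition with a small factor, so a generic sequence keeps all of them bounded. The
class consists of the computable supermartingales for `α`, and of the `α`-computable ones for `β`.

The copying has to be compatible with both constraints (`Cond.isCofinal_decided`,
`Cond.isCofinal_copying`). While `α` is under construction, an `α`-computable supermartingale is
given by a name, an `OracleApprox`. If the name can always be decided further, a computable search
extends the stem of `α` to a computable length `u n` so that all values on strings of length at most
`3n` are settled. Halting stages are not computably bounded, so some large `n` has `t > u n`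
(`exists_haltsAt_gt`). The block of `α` at `t` is then still free when the bets on the block of `β`
are already fixed. Appending the same string `w` to both sides makes the sum of the capital on the
`α` side and a multiple of the capital on the `β` side a supermartingale in `w`, so some `w` does
not raise it. To bound the two summands separately, one starts where the `α` capital is almost
minimal. -/

theorem Computable.sum_range {f : A → ℕ → ℕ} {n : A → ℕ} (hf : Computable₂ f)
    (hn : Computable n) : Computable fun a => ∑ i ∈ Finset.range (n a), f a i := by
  have h : Computable fun a => (Nat.rec 0 (fun i ih => ih + f a i) (n a) : ℕ) :=
    Computable.nat_rec hn (Computable.const 0)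
      (Primrec.nat_add.to_comp.comp (Computable.snd.comp Computable.snd)
        (hf.comp Computable.fst (Computable.fst.comp Computable.snd))).to₂
  refine h.of_eq fun a => ?_
  induction n a with
  | zero => rfl
  | succ k ih => rw [Finset.sum_range_succ, ← ih]

theorem Computable.prod_range {f : A → ℕ → ℕ} {n : A → ℕ} (hf : Computable₂ f)
    (hn : Computable n) : Computable fun a => ∏ i ∈ Finset.range (n a), f a i := by
  have h : Computable fun a => (Nat.rec 1 (fun i ih => ih * f a i) (n a) : ℕ) :=
    Computable.nat_rec hn (Computable.const 1)
      (Primrec.nat_mul.to_comp.comp (Computable.snd.comp Computable.snd)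
        (hf.comp Computable.fst (Computable.fst.comp Computable.snd))).to₂
  refine h.of_eq fun a => ?_
  induction n a with
  | zero => rfl
  | succ k ih => rw [Finset.prod_range_succ, ← ih]

theorem Computable.forall_lt {f : A → ℕ → Bool} {n : A → ℕ} (hf : Computable₂ f)
    (hn : Computable n) : Computable fun a => decide (∀ i < n a, f a i = true) := by
  have h : Computable fun a => (Nat.rec true (fun i ih => ih && f a i) (n a) : Bool) :=
    Computable.nat_rec hn (Computable.const true)
      (Primrec.and.to_comp.comp (Computable.snd.comp Computable.snd)
        (hf.comp Computable.fst (Computable.fst.comp Computable.snd))).to₂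
  refine h.of_eq fun a => ?_
  induction n a with
  | zero => simp
  | succ k ih =>
    simp only [ih]
    rw [Bool.eq_iff_iff]
    simp only [Bool.and_eq_true, decide_eq_true_eq, Nat.lt_succ_iff_lt_or_eq]
    grind

theorem Primrec.nat_pow : Primrec₂ ((· ^ ·) : ℕ → ℕ → ℕ) := by
  have h : Primrec₂ fun a n : ℕ => (Nat.rec 1 (fun _ ih => ih * a) n : ℕ) :=
    Primrec.nat_rec (Primrec.const 1)
      (Primrec.nat_mul.comp (Primrec.snd.comp Primrec.snd) Primrec.fst).to₂
  refine h.of_eq fun a n => ?_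
  induction n with
  | zero => rfl
  | succ k ih => rw [pow_succ, ← ih]

end Bounded

/-! ### Approximations of oracle computations -/

/-- A computable map sending a finite amount `σ` of oracle information and an argument `n` to the
result of an oracle computation, if `σ` suffices to determine it. -/
structure OracleApprox where
  toFun : List Bool → ℕ → Option ℕ
  computable : Computable₂ toFun
  mono : ∀ {σ σ' n v}, σ <+: σ' → toFun σ n = some v → toFun σ' n = some v

namespace OracleApprox

/-- Genericity can handle only countably many requirements, and these approximations index those
imposed on `α`. -/
instance : Countable OracleApprox := by
  let F : OracleApprox → {f : ℕ → ℕ // Computable f} := fun G =>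
    ⟨fun n => Encodable.encode
      ((Encodable.decode n : Option (List Bool × ℕ)).map fun p => G.toFun p.1 p.2),
      Computable.encode.comp (Computable.option_map Computable.decode
        (G.computable.comp (Computable.fst.comp Computable.snd)
          (Computable.snd.comp Computable.snd)).to₂)⟩
  refine Function.Injective.countable (f := F) fun G G' h => ?_
  have h1 := congrArg Subtype.val h
  have h2 : G.toFun = G'.toFun := by
    funext σ n
    have h3 := congrFun h1 (Encodable.encode (σ, n))
    simpa [F] using h3
  cases G; cases G'; congr

/-- The approximation `G` computes the partial function `f` with oracle `α`. -/
def Computes (G : OracleApprox) (α : ℕ → Bool) (f : ℕ →. ℕ) : Prop :=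
  ∀ n v, v ∈ f n ↔ ∃ k, G.toFun (bitPrefix α k) n = some v

end OracleApprox

theorem bitPrefix_length (α : ℕ → Bool) (n : ℕ) : (bitPrefix α n).length = n := by
  simp [bitPrefix]

theorem bitPrefix_mono (α : ℕ → Bool) {m n : ℕ} (h : m ≤ n) : bitPrefix α m <+: bitPrefix α n := by
  obtain ⟨k, rfl⟩ := Nat.exists_eq_add_of_le h
  exact ⟨(List.range k).map fun i => α (m + i), by
    simp [bitPrefix, List.range_add, List.map_append, Function.comp_def]⟩

theorem bitPrefix_getElem? (α : ℕ → Bool) {i n : ℕ} (h : i < n) :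
    (bitPrefix α n)[i]? = some (α i) := by
  simp [bitPrefix, h]

namespace OracleApprox

variable {α : ℕ → Bool} {f h : ℕ →. ℕ}

theorem exists_bound (G : OracleApprox) {k k' n v : ℕ} (hk : k ≤ k')
    (hv : G.toFun (bitPrefix α k) n = some v) : G.toFun (bitPrefix α k') n = some v :=
  G.mono (bitPrefix_mono α hk) hv

theorem computes_of_total {g : ℕ → ℕ} (hg : Computable g) :
    ∃ G : OracleApprox, G.Computes α fun n => Part.some (g n) := by
  refine ⟨⟨fun _ n => some (g n), (Computable.option_some.comp (hg.comp Computable.snd)).to₂,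
    fun _ hv => hv⟩, fun n v => ?_⟩
  simp [eq_comm]

theorem computes_oracle : ∃ G : OracleApprox, G.Computes α (bitOracle α) := by
  refine ⟨⟨fun σ n => σ[n]?.map Bool.toNat, ?_, ?_⟩, fun n v => ?_⟩
  · exact (Computable.option_map (Computable.list_getElem?)
      ((Primrec.dom_bool Bool.toNat).to_comp.comp Computable.snd).to₂)
  · intro σ σ' n v hσ hv
    rw [Option.map_eq_some_iff] at hv ⊢
    obtain ⟨b, hb, rfl⟩ := hv
    exact ⟨b, by
      obtain ⟨t, rfl⟩ := hσ
      rw [List.getElem?_append_left (List.getElem?_eq_some_iff.1 hb).1, hb], rfl⟩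
  · simp only [bitOracle, Part.mem_some_iff, Option.map_eq_some_iff]
    constructor
    · rintro rfl
      exact ⟨n + 1, α n, bitPrefix_getElem? α (Nat.lt_succ_self n), rfl⟩
    · rintro ⟨k, b, hb, rfl⟩
      have hn : n < k := by
        have := (List.getElem?_eq_some_iff.1 hb).1
        rwa [bitPrefix_length] at this
      rw [bitPrefix_getElem? α hn, Option.some_inj] at hb
      rw [hb]

theorem computes_pair (hf : ∃ G : OracleApprox, G.Computes α f)
    (hh : ∃ G : OracleApprox, G.Computes α h) :
    ∃ G : OracleApprox, G.Computes α fun n => Nat.pair <$> f n <*> h n := by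
  obtain ⟨F, hF⟩ := hf
  obtain ⟨H, hH⟩ := hh
  refine ⟨⟨fun σ n => (F.toFun σ n).bind fun a => (H.toFun σ n).map fun b => Nat.pair a b,
    ?_, ?_⟩, fun n v => ?_⟩
  · exact Computable.option_bind F.computable
      (Computable.option_map (H.computable.comp (Computable.fst.comp Computable.fst)
        (Computable.snd.comp Computable.fst))
        (Primrec₂.natPair.to_comp.comp (Computable.snd.comp Computable.fst)
          Computable.snd).to₂).to₂
  · intro σ σ' n v hσ hv
    simp only [Option.bind_eq_some_iff, Option.map_eq_some_iff] at hv ⊢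
    obtain ⟨a, ha, b, hb, rfl⟩ := hv
    exact ⟨a, F.mono hσ ha, b, H.mono hσ hb, rfl⟩
  · simp only [Seq.seq, Option.bind_eq_some_iff, Option.map_eq_some_iff, Part.mem_bind_iff,
      Part.map_eq_map, Part.mem_map_iff]
    constructor
    · rintro ⟨_, ⟨a, ha, rfl⟩, b, hb, rfl⟩
      obtain ⟨k, hk⟩ := (hF n a).1 ha
      obtain ⟨l, hl⟩ := (hH n b).1 hb
      exact ⟨max k l, a, F.exists_bound (le_max_left _ _) hk, b,
        H.exists_bound (le_max_right _ _) hl, rfl⟩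
    · rintro ⟨k, a, ha, b, hb, rfl⟩
      exact ⟨_, ⟨a, (hF n a).2 ⟨k, ha⟩, rfl⟩, b, (hH n b).2 ⟨k, hb⟩, rfl⟩

theorem computes_comp (hf : ∃ G : OracleApprox, G.Computes α f)
    (hh : ∃ G : OracleApprox, G.Computes α h) :
    ∃ G : OracleApprox, G.Computes α fun n => h n >>= f := by
  obtain ⟨F, hF⟩ := hf
  obtain ⟨H, hH⟩ := hh
  refine ⟨⟨fun σ n => (H.toFun σ n).bind fun a => F.toFun σ a, ?_, ?_⟩, fun n v => ?_⟩
  · exact Computable.option_bind H.computable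
      (F.computable.comp (Computable.fst.comp Computable.fst) Computable.snd).to₂
  · intro σ σ' n v hσ hv
    simp only [Option.bind_eq_some_iff] at hv ⊢
    obtain ⟨a, ha, hb⟩ := hv
    exact ⟨a, H.mono hσ ha, F.mono hσ hb⟩
  · refine Part.mem_bind_iff.trans ?_
    simp only [Option.bind_eq_some_iff]
    constructor
    · rintro ⟨a, ha, hv⟩
      obtain ⟨k, hk⟩ := (hH n a).1 ha
      obtain ⟨l, hl⟩ := (hF a v).1 hv
      exact ⟨max k l, a, H.exists_bound (le_max_left _ _) hk, F.exists_bound (le_max_right _ _) hl⟩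
    · rintro ⟨k, a, ha, hv⟩
      exact ⟨a, (hH n a).2 ⟨k, ha⟩, (hF a v).2 ⟨k, hv⟩⟩

theorem computes_prec (hf : ∃ G : OracleApprox, G.Computes α f)
    (hh : ∃ G : OracleApprox, G.Computes α h) :
    ∃ G : OracleApprox, G.Computes α fun p =>
      (Nat.rec (f p.unpair.1)
        (fun y IH => IH.bind fun i => h (Nat.pair p.unpair.1 (Nat.pair y i)))
        p.unpair.2 : Part ℕ) := by
  obtain ⟨F, hF⟩ := hf
  obtain ⟨H, hH⟩ := hh
  have hrec : Computable fun q : (List Bool × ℕ) × ℕ => (Nat.rec (F.toFun q.1.1 q.1.2)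
      (fun y IH => IH.bind fun i => H.toFun q.1.1 (Nat.pair q.1.2 (Nat.pair y i)))
      q.2 : Option ℕ) := by
    have hstep : Computable₂ fun (r : ((List Bool × ℕ) × ℕ) × ℕ × Option ℕ) (i : ℕ) =>
        H.toFun r.1.1.1 (Nat.pair r.1.1.2 (Nat.pair r.2.1 i)) :=
      (H.computable.comp
        (Computable.fst.comp (Computable.fst.comp (Computable.fst.comp Computable.fst)))
        (Primrec₂.natPair.to_comp.comp
          (Computable.snd.comp (Computable.fst.comp (Computable.fst.comp Computable.fst)))
          (Primrec₂.natPair.to_comp.comp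
            (Computable.fst.comp (Computable.snd.comp Computable.fst)) Computable.snd))).to₂
    have hIH : Computable fun r : ((List Bool × ℕ) × ℕ) × ℕ × Option ℕ => r.2.2 :=
      Computable.snd.comp Computable.snd
    have hbind : Computable₂ fun (q : (List Bool × ℕ) × ℕ) (r : ℕ × Option ℕ) =>
        r.2.bind fun i => H.toFun q.1.1 (Nat.pair q.1.2 (Nat.pair r.1 i)) :=
      Computable.option_bind hIH hstep
    have hbase : Computable fun q : (List Bool × ℕ) × ℕ => F.toFun q.1.1 q.1.2 :=
      F.computable.comp (Computable.fst.comp Computable.fst)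
        (Computable.snd.comp Computable.fst)
    have h := Computable.nat_rec Computable.snd hbase hbind
    exact h
  have hunpair : Computable fun q : List Bool × ℕ => ((q.1, q.2.unpair.1), q.2.unpair.2) :=
    Computable.pair (Computable.pair Computable.fst
      (Computable.fst.comp (Computable.unpair.comp Computable.snd)))
      (Computable.snd.comp (Computable.unpair.comp Computable.snd))
  have hmono : ∀ {σ σ' : List Bool} {a n v : ℕ}, σ <+: σ' →
      (Nat.rec (F.toFun σ a)
        (fun y IH => IH.bind fun i => H.toFun σ (Nat.pair a (Nat.pair y i))) n : Option ℕ) = some v →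
      (Nat.rec (F.toFun σ' a)
        (fun y IH => IH.bind fun i => H.toFun σ' (Nat.pair a (Nat.pair y i))) n : Option ℕ) =
        some v := by
    intro σ σ' a n
    induction n with
    | zero => intro v hσ hv; exact F.mono hσ hv
    | succ n ih =>
      intro v hσ hv
      obtain ⟨i, hi, hv⟩ := Option.bind_eq_some_iff.1 hv
      exact Option.bind_eq_some_iff.2 ⟨i, ih hσ hi, H.mono hσ hv⟩
  refine ⟨⟨_, (hrec.comp hunpair).to₂, hmono⟩, fun p => ?_⟩
  dsimp only
  generalize p.unpair.1 = a
  induction p.unpair.2 with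
  | zero => exact hF a
  | succ n ih =>
    intro v
    refine Part.mem_bind_iff.trans ⟨?_, ?_⟩
    · rintro ⟨i, hi, hv⟩
      obtain ⟨k, hk⟩ := (ih i).1 hi
      obtain ⟨l, hl⟩ := (hH _ v).1 hv
      exact ⟨max k l, Option.bind_eq_some_iff.2 ⟨i, hmono (bitPrefix_mono α (le_max_left _ _)) hk,
        H.exists_bound (le_max_right _ _) hl⟩⟩
    · rintro ⟨k, hk⟩
      obtain ⟨i, hi, hv⟩ := Option.bind_eq_some_iff.1 hk
      exact ⟨i, (ih i).2 ⟨k, hi⟩, (hH _ v).2 ⟨k, hv⟩⟩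

/-- Search for the least zero of `u` below a bound. The result is `none` if some required value of
`u` is missing, and `some none` if all values are present and none of them is zero. -/
def search (u : ℕ → Option ℕ) : ℕ → Option (Option ℕ)
  | 0 => some none
  | N + 1 =>
    match search u N with
    | none => none
    | some (some m) => some (some m)
    | some none =>
      match u N with
      | none => none
      | some 0 => some (some N)
      | some (_ + 1) => some none

theorem search_eq_none_iff (u : ℕ → Option ℕ) (N : ℕ) :
    search u N = some none ↔ ∀ j < N, ∃ v, u j = some v ∧ v ≠ 0 := by
  induction N with
  | zero => simp [search]
  | succ N ih =>
    rw [Nat.forall_lt_succ_right, ← ih]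
    rcases hs : search u N with _ | _ | m
    · simp [search, hs]
    · rcases hu : u N with _ | _ | v <;> simp [search, hs, hu]
    · simp [search, hs]

theorem search_eq_some_iff (u : ℕ → Option ℕ) (N m : ℕ) :
    search u N = some (some m) ↔
      m < N ∧ u m = some 0 ∧ ∀ j < m, ∃ v, u j = some v ∧ v ≠ 0 := by
  induction N with
  | zero => simp [search]
  | succ N ih =>
    have h0 := search_eq_none_iff u N
    rcases hs : search u N with _ | _ | m'
    · simp only [search, hs, reduceCtorEq, false_iff] at ih h0 ⊢
      rintro ⟨h1, h2, h3⟩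
      rcases Nat.lt_succ_iff_lt_or_eq.1 h1 with h | rfl
      · exact ih ⟨h, h2, h3⟩
      · exact h0 h3
    · simp only [hs, true_iff, Option.some_inj, reduceCtorEq, false_iff] at ih h0
      rcases hu : u N with _ | _ | v
      · simp only [search, hs, hu, reduceCtorEq, false_iff]
        grind
      · simp only [search, hs, hu, Option.some_inj]
        constructor
        · rintro rfl
          exact ⟨Nat.lt_succ_self _, hu, h0⟩
        · rintro ⟨h1, h2, h3⟩
          rcases Nat.lt_succ_iff_lt_or_eq.1 h1 with h | rfl
          · exact absurd ⟨h, h2, h3⟩ ih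
          · rfl
      · simp only [search, hs, hu, Option.some_inj, reduceCtorEq, false_iff]
        grind
    · have hs' : search u (N + 1) = some (some m') := by simp [search, hs]
      rw [hs', ← hs, ih]
      constructor
      · rintro ⟨h1, h2⟩
        exact ⟨Nat.lt_succ_of_lt h1, h2⟩
      · rintro ⟨h1, h2, h3⟩
        refine ⟨?_, h2, h3⟩
        rcases Nat.lt_succ_iff_lt_or_eq.1 h1 with h | rfl
        · exact h
        · exact absurd (h0.2 h3) (by simp [hs])

theorem computable_search {A : Type*} [Primcodable A] {u : A → ℕ → Option ℕ} {N : A → ℕ}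
    (hu : Computable₂ u) (hN : Computable N) : Computable fun a => search (u a) (N a) := by
  have h : Computable fun a => (Nat.rec (some none) (fun i s => s.bind fun o => Option.casesOn o
      ((u a i).map fun v => (Nat.casesOn v (some i) fun _ => none : Option ℕ))
      fun m => some (some m)) (N a) : Option (Option ℕ)) := by
    have hv : Computable₂ fun (r : (A × ℕ × Option (Option ℕ)) × Option ℕ) (v : ℕ) =>
        (Nat.casesOn v (some r.1.2.1) fun _ => none : Option ℕ) :=
      (Computable.nat_casesOn Computable.snd (Computable.option_some.comp
        (Computable.fst.comp (Computable.snd.comp (Computable.fst.comp Computable.fst))))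
        (Computable.const none).to₂).to₂
    have hm : Computable₂ fun (r : A × ℕ × Option (Option ℕ)) (o : Option ℕ) =>
        (Option.casesOn o
          ((u r.1 r.2.1).map fun v => (Nat.casesOn v (some r.2.1) fun _ => none : Option ℕ))
          fun m => some (some m) : Option (Option ℕ)) :=
      (Computable.option_casesOn Computable.snd
        (Computable.option_map (hu.comp (Computable.fst.comp Computable.fst)
          (Computable.fst.comp (Computable.snd.comp Computable.fst))) hv)
        (Computable.option_some.comp (Computable.option_some.comp Computable.snd)).to₂).to₂
    exact Computable.nat_rec hN (Computable.const (some none))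
      (Computable.option_bind (Computable.snd.comp Computable.snd) hm).to₂
  refine h.of_eq fun a => ?_
  induction N a with
  | zero => rfl
  | succ k ih =>
    simp only [ih, search]
    rcases search (u a) k with _ | _ | m
    · rfl
    · rcases u a k with _ | _ | v <;> rfl
    · rfl

/-- The length of the oracle prefix also serves as the bound of the search, which keeps the
approximation total. A longer prefix cannot change the answer, because all values before the zero
were already known to be nonzero. -/
theorem computes_rfind (hf : ∃ G : OracleApprox, G.Computes α f) :
    ∃ G : OracleApprox, G.Computes α fun a =>
      Nat.rfind fun n => (fun m => m = 0) <$> f (Nat.pair a n) := by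
  obtain ⟨F, hF⟩ := hf
  let R : List Bool → ℕ → Option (Option ℕ) := fun σ a =>
    search (fun i => F.toFun σ (Nat.pair a i)) σ.length
  have hR : ∀ σ a m, R σ a = some (some m) ↔ m < σ.length ∧ F.toFun σ (Nat.pair a m) = some 0 ∧
      ∀ j < m, ∃ v, F.toFun σ (Nat.pair a j) = some v ∧ v ≠ 0 :=
    fun σ a m => search_eq_some_iff (fun i => F.toFun σ (Nat.pair a i)) σ.length m
  refine ⟨⟨fun σ a => (R σ a).bind id, ?_, ?_⟩, fun a m => ?_⟩
  · have hs : Computable fun p : List Bool × ℕ => R p.1 p.2 := ?_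
    · exact Computable.option_bind hs Computable.snd.to₂
    refine computable_search (A := List Bool × ℕ) (u := fun p i => F.toFun p.1 (Nat.pair p.2 i))
      (N := fun p => p.1.length) ?_ (Computable.list_length.comp Computable.fst)
    exact (F.computable.comp (Computable.fst.comp Computable.fst)
      (Primrec₂.natPair.to_comp.comp (Computable.snd.comp Computable.fst) Computable.snd)).to₂
  · intro σ σ' a v hσ hv
    simp only [Option.bind_eq_some_iff, id, exists_eq_right, hR] at hv ⊢
    obtain ⟨h1, h2, h3⟩ := hv
    refine ⟨h1.trans_le hσ.length_le, F.mono hσ h2, fun j hj => ?_⟩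
    obtain ⟨w, hw, hw0⟩ := h3 j hj
    exact ⟨w, F.mono hσ hw, hw0⟩
  · have hb : ∀ n b, b ∈ ((fun m => decide (m = 0)) <$> f (Nat.pair a n) : Part Bool) ↔
        ∃ v ∈ f (Nat.pair a n), decide (v = 0) = b := by
      simp [Part.map_eq_map, Part.mem_map_iff]
    simp only [Option.bind_eq_some_iff, id, exists_eq_right, hR, bitPrefix_length]
    refine Nat.mem_rfind.trans ?_
    simp only [hb, decide_eq_true_eq, decide_eq_false_iff_not]
    constructor
    · rintro ⟨⟨v, hv, rfl⟩, h2⟩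
      obtain ⟨k, hk⟩ := (hF _ _).1 hv
      have h4 : ∀ N ≤ m, ∃ k, ∀ j < N,
          ∃ v, F.toFun (bitPrefix α k) (Nat.pair a j) = some v ∧ v ≠ 0 := by
        intro N
        induction N with
        | zero => exact fun _ => ⟨0, by simp⟩
        | succ N ih =>
          intro hN
          obtain ⟨k, hk⟩ := ih (Nat.le_of_succ_le hN)
          obtain ⟨v, hv, hv0⟩ := h2 (m := N) hN
          obtain ⟨l, hl⟩ := (hF _ _).1 hv
          refine ⟨max k l, fun j hj => ?_⟩
          rcases Nat.lt_succ_iff_lt_or_eq.1 hj with hj | rfl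
          · obtain ⟨w, hw, hw0⟩ := hk j hj
            exact ⟨w, F.exists_bound (le_max_left _ _) hw, hw0⟩
          · exact ⟨v, F.exists_bound (le_max_right _ _) hl, hv0⟩
      obtain ⟨l, hl⟩ := h4 m le_rfl
      refine ⟨max (m + 1) (max k l), by omega, F.exists_bound (by omega) hk, fun j hj => ?_⟩
      obtain ⟨w, hw, hw0⟩ := hl j hj
      exact ⟨w, F.exists_bound (by omega) hw, hw0⟩
    · rintro ⟨k, h1, h2, h3⟩
      refine ⟨⟨0, (hF _ _).2 ⟨k, h2⟩, rfl⟩, fun {j} hj => ?_⟩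
      obtain ⟨w, hw, hw0⟩ := h3 j hj
      exact ⟨w, (hF _ _).2 ⟨k, hw⟩, hw0⟩

end OracleApprox

open OracleApprox in
/-- The use principle: a computation with oracle `α` depends on finitely many bits of `α`. -/
theorem Nat.RecursiveIn.exists_computes {α : ℕ → Bool} {f : ℕ →. ℕ}
    (hf : Nat.RecursiveIn {bitOracle α} f) : ∃ G : OracleApprox, G.Computes α f := by
  induction hf with
  | zero => exact computes_of_total (g := fun _ => 0) (Computable.const 0)
  | succ => exact computes_of_total Computable.succ
  | left => exact computes_of_total (Computable.fst.comp Computable.unpair)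
  | right => exact computes_of_total (Computable.snd.comp Computable.unpair)
  | oracle g hg =>
    rw [Set.mem_singleton_iff.1 hg]
    exact computes_oracle
  | pair _ _ ihf ihh => exact computes_pair ihf ihh
  | comp _ _ ihf ihh => exact computes_comp ihf ihh
  | prec _ _ ihf ihh => exact computes_prec ihf ihh
  | rfind _ ihf => exact computes_rfind ihf

/-! ### Supermartingales with rational values -/

/-- The capital `H x / (D * 2 ^ |x|)` described by a natural-number-valued function `H`. -/
noncomputable def capital (H : List Bool → ℕ) (D : ℕ) (x : List Bool) : ℝ :=
  H x / (D * 2 ^ x.length)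

/-- `capital H D` is a supermartingale. -/
def IsSuper (H : List Bool → ℕ) : Prop :=
  ∀ x, H (x ++ [false]) + H (x ++ [true]) ≤ 4 * H x

/-- A class of functions that is countable and closed under linear combinations. -/
structure IsCapitalClass (C : (List Bool → ℕ) → Prop) : Prop where
  countable : Countable {H // C H}
  zero : C fun _ => 0
  lin : ∀ {H H'} (a b : ℕ), C H → C H' → C fun x => a * H x + b * H' x

/-- `M` is a supermartingale `capital H D` with `H` in the class `C`. -/
def IsCapital (C : (List Bool → ℕ) → Prop) (M : List Bool → ℝ) : Prop :=
  ∃ H D, C H ∧ IsSuper H ∧ 0 < D ∧ M = capital H D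

theorem capital_nonneg (H : List Bool → ℕ) (D : ℕ) (x : List Bool) : 0 ≤ capital H D x := by
  unfold capital; positivity

/-- The constraint of a condition becomes a comparison of natural numbers, hence decidable when `H`
is computable. -/
theorem capital_lt_iff {H : List Bool → ℕ} {D : ℕ} (hD : 0 < D) (x : List Bool) :
    capital H D x < 1 ↔ H x < D * 2 ^ x.length := by
  rw [capital, div_lt_one (by positivity)]
  exact_mod_cast Iff.rfl

theorem capital_average {H : List Bool → ℕ} {D : ℕ} (hD : 0 < D) {x : List Bool}
    (h : H (x ++ [false]) + H (x ++ [true]) ≤ 4 * H x) :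
    capital H D (x ++ [false]) + capital H D (x ++ [true]) ≤ 2 * capital H D x := by
  simp only [capital, List.length_append, List.length_singleton, pow_succ]
  have h' : (H (x ++ [false]) : ℝ) + H (x ++ [true]) ≤ 4 * H x := by exact_mod_cast h
  have hD' : (0 : ℝ) < D := by exact_mod_cast hD
  rw [← add_div, ← mul_div_assoc, div_le_div_iff₀ (by positivity) (by positivity)]
  have : (0 : ℝ) < D * 2 ^ x.length := by positivity
  nlinarith

namespace IsCapital

variable {C : (List Bool → ℕ) → Prop} {M M' : List Bool → ℝ}

theorem nonneg (h : IsCapital C M) (x : List Bool) : 0 ≤ M x := by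
  obtain ⟨H, D, -, -, -, rfl⟩ := h
  exact capital_nonneg H D x

theorem average (h : IsCapital C M) (x : List Bool) :
    M (x ++ [false]) + M (x ++ [true]) ≤ 2 * M x := by
  obtain ⟨H, D, -, hs, hD, rfl⟩ := h
  exact capital_average hD (hs x)

theorem zero (hC : IsCapitalClass C) : IsCapital C fun _ => 0 :=
  ⟨fun _ => 0, 1, hC.zero, fun _ => by simp, one_pos, by funext x; simp [capital]⟩

theorem add_div (hC : IsCapitalClass C) (h : IsCapital C M) (h' : IsCapital C M') {K : ℕ}
    (hK : 0 < K) : IsCapital C fun x => M x + M' x / K := by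
  obtain ⟨H, D, hH, hs, hD, rfl⟩ := h
  obtain ⟨H', D', hH', hs', hD', rfl⟩ := h'
  refine ⟨_, D * (D' * K), hC.lin (D' * K) D hH hH', fun x => ?_, by positivity, ?_⟩
  · have h1 := Nat.mul_le_mul_left (D' * K) (hs x)
    have h2 := Nat.mul_le_mul_left D (hs' x)
    simp only
    linarith
  · funext x
    simp only [capital]
    push_cast
    field_simp

theorem mul_div (hC : IsCapitalClass C) (h : IsCapital C M) (a : ℕ) {b : ℕ} (hb : 0 < b) :
    IsCapital C fun x => M x * a / b := by
  obtain ⟨H, D, hH, hs, hD, rfl⟩ := h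
  refine ⟨_, D * b, hC.lin a 0 hH hC.zero, fun x => ?_, by positivity, ?_⟩
  · have h1 := Nat.mul_le_mul_left a (hs x)
    simp only
    linarith
  · funext x
    simp only [capital]
    push_cast
    field_simp
    ring

end IsCapital

/-- A function on strings that does not increase on average when a bit is appended does not
increase along some string of any prescribed length. -/
theorem exists_path_le (Φ : List Bool → ℝ) (k : ℕ)
    (h : ∀ w, w.length < k → Φ (w ++ [false]) + Φ (w ++ [true]) ≤ 2 * Φ w) :
    ∃ w, w.length = k ∧ ∀ w', w' <+: w → Φ w' ≤ Φ [] := by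
  induction k with
  | zero => exact ⟨[], rfl, fun w' hw' => by rw [List.prefix_nil.1 hw']⟩
  | succ k ih =>
    obtain ⟨w, hw, hle⟩ := ih fun w hw => h w (Nat.lt_succ_of_lt hw)
    have h1 := h w (by omega)
    have h2 := hle w List.prefix_rfl
    obtain ⟨b, hb⟩ : ∃ b, Φ (w ++ [b]) ≤ Φ [] := by
      by_contra! hcon
      have h3 := hcon false
      have h4 := hcon true
      linarith
    refine ⟨w ++ [b], by simp [hw], fun w' hw' => ?_⟩
    rcases List.prefix_concat_iff.1 hw' with rfl | h'
    · exact hb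
    · exact hle w' h'

/-! ### Forcing with capital constraints -/

/-- A condition: a finite string together with a supermartingale that is to stay below `1` on all
further prefixes. -/
structure Cond (C : (List Bool → ℕ) → Prop) where
  stem : List Bool
  cap : List Bool → ℝ
  isCapital : IsCapital C cap
  cap_lt : cap stem < 1

namespace Cond

variable {C : (List Bool → ℕ) → Prop}

/-- Larger conditions are stronger. The bound on all intermediate prefixes is what passes to the
limit as `Below`; capitals that only grow make the relation transitive. -/
instance : Preorder (Cond C) where
  le p q := p.stem <+: q.stem ∧ (∀ ρ, p.stem <+: ρ → ρ <+: q.stem → p.cap ρ < 1) ∧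
    ∀ x, p.cap x ≤ q.cap x
  le_refl p := ⟨List.prefix_rfl, fun ρ h h' => by
    rw [h'.eq_of_length (le_antisymm h'.length_le h.length_le)]; exact p.cap_lt, fun _ => le_rfl⟩
  le_trans p q r hpq hqr := by
    refine ⟨hpq.1.trans hqr.1, fun ρ h h' => ?_, fun x => (hpq.2.2 x).trans (hqr.2.2 x)⟩
    rcases List.prefix_or_prefix_of_prefix h' hqr.1 with h1 | h1
    · exact hpq.2.1 ρ h h1
    · exact (hpq.2.2 ρ).trans_lt (hqr.2.1 ρ h1 h')

/-- The infinite sequence `α` satisfies the condition `p`. -/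
def Below (p : Cond C) (α : ℕ → Bool) : Prop :=
  p.stem = bitPrefix α p.stem.length ∧ ∀ k ≥ p.stem.length, p.cap (bitPrefix α k) < 1

/-- The condition `p` with its stem replaced by an initial segment of a sequence satisfying it. -/
def Below.extend {p : Cond C} {α : ℕ → Bool} (h : p.Below α) {k : ℕ} (hk : p.stem.length ≤ k) :
    Cond C :=
  ⟨bitPrefix α k, p.cap, p.isCapital, h.2 k hk⟩

theorem prefix_bitPrefix_eq {α : ℕ → Bool} {x : List Bool} {k : ℕ} (h : x <+: bitPrefix α k) :
    x = bitPrefix α x.length := by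
  have hl := h.length_le
  rw [bitPrefix_length] at hl
  have h1 : bitPrefix α x.length <+: bitPrefix α k := bitPrefix_mono α hl
  exact (List.prefix_of_prefix_length_le h h1 (bitPrefix_length α _).ge).eq_of_length
    (bitPrefix_length α _).symm

theorem Below.le_extend {p : Cond C} {α : ℕ → Bool} (h : p.Below α) {k : ℕ}
    (hk : p.stem.length ≤ k) : p ≤ h.extend hk := by
  refine ⟨?_, fun ρ h1 h2 => ?_, fun _ => le_rfl⟩
  · rw [h.1]; exact bitPrefix_mono α hk
  · rw [prefix_bitPrefix_eq h2]; exact h.2 _ h1.length_le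

/-- Extend the stem of a condition along a string on which the capital stays below `1`. -/
def append (p : Cond C) (w : List Bool) (h : ∀ w', w' <+: w → p.cap (p.stem ++ w') < 1) :
    Cond C :=
  ⟨p.stem ++ w, p.cap, p.isCapital, h w List.prefix_rfl⟩

theorem le_append (p : Cond C) (w : List Bool)
    (h : ∀ w', w' <+: w → p.cap (p.stem ++ w') < 1) : p ≤ p.append w h := by
  refine ⟨List.prefix_append _ _, ?_, fun _ => le_rfl⟩
  rintro ρ ⟨t, rfl⟩ hρ
  exact h t ((List.prefix_append_right_inj _).1 hρ)

/-- The stem of `q` with the capital of a weaker condition. -/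
def weaken {p q : Cond C} (h : p ≤ q) : Cond C :=
  ⟨q.stem, p.cap, p.isCapital, h.2.1 _ h.1 List.prefix_rfl⟩

theorem le_weaken {p q : Cond C} (h : p ≤ q) : p ≤ weaken h :=
  ⟨h.1, h.2.1, fun _ => le_rfl⟩

theorem exists_append (p : Cond C) (n : ℕ) :
    ∃ w, w.length = n ∧ ∀ w', w' <+: w → p.cap (p.stem ++ w') ≤ p.cap p.stem := by
  simpa using exists_path_le (fun w => p.cap (p.stem ++ w)) n fun w _ => by
    simpa using p.isCapital.average (p.stem ++ w)

theorem isCofinal_length (n : ℕ) : IsCofinal {p : Cond C | n ≤ p.stem.length} := by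
  intro p
  obtain ⟨w, hw, hle⟩ := p.exists_append n
  exact ⟨p.append w fun w' hw' => (hle w' hw').trans_lt p.cap_lt, by simp [append, hw],
    p.le_append w _⟩

/-- The gap between `1` and the capital at the stem leaves room for `capital H 1 / K` once `K` is
large enough; a generic sequence then keeps `capital H 1` below `K` from some point on. -/
theorem isCofinal_bounded (hC : IsCapitalClass C) {H : List Bool → ℕ} (hH : C H)
    (hs : IsSuper H) : IsCofinal {p : Cond C | ∃ K : ℕ, 0 < K ∧ ∀ x, capital H 1 x ≤ K * p.cap x} := by
  intro p
  obtain ⟨K, hK⟩ := exists_nat_gt (capital H 1 p.stem / (1 - p.cap p.stem))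
  have h1 : 0 < 1 - p.cap p.stem := sub_pos.2 p.cap_lt
  have hK0 : (0 : ℝ) < K := (div_nonneg (capital_nonneg _ _ _) h1.le).trans_lt hK
  have hKn : 0 < K := by exact_mod_cast hK0
  refine ⟨⟨p.stem, _, p.isCapital.add_div hC ⟨H, 1, hH, hs, one_pos, rfl⟩ hKn, ?_⟩,
    ⟨K, hKn, fun x => ?_⟩, List.prefix_rfl, fun ρ h h' => ?_, fun x => ?_⟩
  · rw [div_lt_iff₀ h1, mul_comm, ← div_lt_iff₀ hK0] at hK
    linarith
  · have := p.isCapital.nonneg x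
    simp only
    rw [mul_add, mul_div_cancel₀ _ hK0.ne']
    nlinarith
  · rw [h'.eq_of_length (le_antisymm h'.length_le h.length_le)]; exact p.cap_lt
  · have := div_nonneg (capital_nonneg H 1 x) hK0.le
    simp only
    linarith

/-- Existence of sequences that are sufficiently generic for the forcing with conditions. -/
theorem exists_generic (hC : IsCapitalClass C) {ι : Type} [Countable ι] (𝒟 : ι → Set (Cond C))
    (h𝒟 : ∀ i, IsCofinal (𝒟 i)) :
    ∃ α : ℕ → Bool,
      (∀ H, C H → IsSuper H → BddAbove (Set.range fun k => capital H 1 (bitPrefix α k))) ∧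
        ∀ i, ∃ p ∈ 𝒟 i, p.Below α := by
  have := hC.countable
  obtain ⟨hι⟩ := nonempty_encodable (({H // C H} ⊕ ι) ⊕ ℕ)
  -- The requirements are to bound each supermartingale of the class, to meet each given cofinal
  -- set, and to make the stems arbitrarily long.
  let E : ({H // C H} ⊕ ι) ⊕ ℕ → Order.Cofinal (Cond C) := Sum.elim (Sum.elim
    (fun H => ⟨{p | IsSuper H.1 → ∃ K : ℕ, 0 < K ∧ ∀ x, capital H.1 1 x ≤ K * p.cap x}, by
      by_cases hs : IsSuper H.1
      · simpa [hs] using isCofinal_bounded hC H.2 hs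
      · simp [hs, IsCofinal.univ]⟩)
    fun i => ⟨𝒟 i, h𝒟 i⟩) fun n => ⟨{p | n ≤ p.stem.length}, isCofinal_length n⟩
  let p0 : Cond C := ⟨[], fun _ => 0, IsCapital.zero hC, one_pos⟩
  let s := Order.sequenceOfCofinals p0 E
  have hs : Monotone s := Order.sequenceOfCofinals.monotone p0 E
  have hmem : ∀ e, s (Encodable.encode e + 1) ∈ E e := Order.sequenceOfCofinals.encode_mem p0 E
  have hlen : ∀ n, ∃ m, n ≤ (s m).stem.length := fun n => ⟨_, hmem (Sum.inr n)⟩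
  choose N hN using fun n => hlen (n + 1)
  -- The default `false` is never used, as the stem with index `N i` is longer than `i`.
  let α : ℕ → Bool := fun i => ((s (N i)).stem[i]?).getD false
  have hα : ∀ n i, i < (s n).stem.length → (s n).stem[i]? = some (α i) := by
    intro n i hi
    have h1 : i < (s (N i)).stem.length := hN i
    have h2 : (s (N i)).stem[i]? = some (α i) := by
      simp [α, List.getElem?_eq_getElem h1]
    rw [← h2]
    rcases le_total n (N i) with h | h
    · obtain ⟨t, ht⟩ := (hs h).1
      rw [← ht, List.getElem?_append_left hi]
    · obtain ⟨t, ht⟩ := (hs h).1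
      rw [← ht, List.getElem?_append_left h1]
  have hstem : ∀ n, (s n).stem = bitPrefix α (s n).stem.length := by
    intro n
    refine List.ext_getElem? fun i => ?_
    by_cases hi : i < (s n).stem.length
    · rw [hα n i hi, bitPrefix_getElem? α hi]
    · rw [List.getElem?_eq_none (not_lt.1 hi),
        List.getElem?_eq_none (by rw [bitPrefix_length]; exact not_lt.1 hi)]
  have hbelow : ∀ n, (s n).Below α := by
    refine fun n => ⟨hstem n, fun k hk => ?_⟩
    have h1 : k ≤ (s (max n (N k))).stem.length :=
      (Nat.le_of_succ_le (hN k)).trans (hs (le_max_right n (N k))).1.length_le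
    refine (hs (le_max_left n (N k))).2.1 _ ?_ ?_
    · rw [hstem n]; exact bitPrefix_mono α hk
    · rw [hstem (max n (N k))]; exact bitPrefix_mono α h1
  refine ⟨α, fun H hH hsup => ?_, fun i => ⟨_, hmem (Sum.inl (Sum.inr i)), hbelow _⟩⟩
  obtain ⟨K, hK, hle⟩ := hmem (Sum.inl (Sum.inl ⟨H, hH⟩)) hsup
  obtain ⟨n, hle⟩ : ∃ n, ∀ x, capital H 1 x ≤ K * (s n).cap x := ⟨_, hle⟩
  refine ((((Finset.range (s n).stem.length).image
    fun k => capital H 1 (bitPrefix α k)).bddAbove).union (bddAbove_Iic (a := (K : ℝ)))).mono ?_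
  rintro _ ⟨k, rfl⟩
  by_cases hk : k < (s n).stem.length
  · left
    simp only [Finset.coe_image, Finset.coe_range, Set.mem_image, Set.mem_Iio]
    exact ⟨k, hk, rfl⟩
  · right
    have h1 := (hbelow n).2 k (not_lt.1 hk)
    have h2 : (0 : ℝ) < K := by exact_mod_cast hK
    exact (hle _).trans (by nlinarith)

end Cond

/-! ### From computable martingales to supermartingales with rational values -/

/-- The numerator approximates `32 * 2 ^ |x| * f x + 32` within `1`. The extra `32` is a capital `32
/ 2 ^ |x|` that halves with every bit, and this loss absorbs the rounding errors in the
supermartingale inequality. -/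
theorem IsMartingale.exists_capital {f : List Bool → ℝ} (hf : IsMartingale f)
    {a b : List Bool → ℕ}
    (hab : ∀ x, |f x - ((a x : ℝ) - b x) / 2 ^ (x.length + 5)| ≤ 1 / 2 ^ (x.length + 5)) :
    IsSuper (fun x => a x + 32 - b x) ∧
      ∀ x, f x ≤ capital (fun x => a x + 32 - b x) 1 x := by
  have key : ∀ x, |32 * 2 ^ x.length * f x - ((a x : ℝ) - b x)| ≤ 1 := by
    intro x
    have h := hab x
    have hp : (0 : ℝ) < 2 ^ (x.length + 5) := by positivity
    have e : f x - ((a x : ℝ) - b x) / 2 ^ (x.length + 5) =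
        (32 * 2 ^ x.length * f x - ((a x : ℝ) - b x)) / 2 ^ (x.length + 5) := by
      field_simp
      ring
    rwa [e, abs_div, abs_of_pos hp, div_le_div_iff_of_pos_right hp] at h
  -- The subtraction is not truncated: since `f` is nonnegative, `a x - b x` is at least `-1`.
  have hcast : ∀ x, ((a x + 32 - b x : ℕ) : ℝ) = a x + 32 - b x := by
    intro x
    have h := abs_le.1 (key x)
    have h0 := mul_nonneg (by positivity : (0 : ℝ) ≤ 32 * 2 ^ x.length) (hf.nonneg x)
    have : (b x : ℝ) ≤ a x + 32 := by linarith
    rw [Nat.cast_sub (by exact_mod_cast this)]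
    push_cast
    ring
  constructor
  · intro x
    have h := abs_le.1 (key x)
    have h0 := abs_le.1 (key (x ++ [false]))
    have h1 := abs_le.1 (key (x ++ [true]))
    simp only [List.length_append, List.length_singleton, pow_succ] at h0 h1
    have hav : 32 * 2 ^ x.length * f x =
        32 * 2 ^ x.length * ((f (x ++ [false]) + f (x ++ [true])) / 2) := by
      rw [← hf.average x]
    have : (((a (x ++ [false]) + 32 - b (x ++ [false]) : ℕ) : ℝ) +
        ((a (x ++ [true]) + 32 - b (x ++ [true]) : ℕ) : ℝ)) ≤
        4 * ((a x + 32 - b x : ℕ) : ℝ) := by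
      rw [hcast, hcast, hcast]
      nlinarith
    exact_mod_cast this
  · intro x
    have h := abs_le.1 (key x)
    rw [capital, hcast, le_div_iff₀ (by positivity)]
    have h0 := mul_nonneg (by positivity : (0 : ℝ) ≤ 2 ^ x.length) (hf.nonneg x)
    push_cast
    nlinarith

/-! ### The computable and the relatively computable supermartingales -/

theorem isCapitalClass_computable :
    IsCapitalClass fun H : List Bool → ℕ => Computable H where
  countable := by
    let F : {H : List Bool → ℕ // Computable H} → {f : ℕ → ℕ // Computable f} := fun H =>
      ⟨fun n => Encodable.encode ((Encodable.decode n : Option (List Bool)).map H.1),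
        Computable.encode.comp (Computable.option_map Computable.decode
          (H.2.comp Computable.snd).to₂)⟩
    refine Function.Injective.countable (f := F) fun H H' h => Subtype.ext (funext fun x => ?_)
    have h1 := congrFun (congrArg Subtype.val h) (Encodable.encode x)
    simpa [F] using h1
  zero := Computable.const 0
  lin a b hH hH' := Primrec.nat_add.to_comp.comp
    (Primrec.nat_mul.to_comp.comp (Computable.const a) hH)
    (Primrec.nat_mul.to_comp.comp (Computable.const b) hH')

/-- The function `H` is computed by the approximation `G` with oracle `α`. -/
def OracleApprox.ComputesTotal (G : OracleApprox) (α : ℕ → Bool) (H : List Bool → ℕ) : Prop :=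
  ∀ x, ∃ k, G.toFun (bitPrefix α k) (Encodable.encode x) = some (H x)

/-- Countability holds because one approximation computes at most one total function with oracle
`α`. -/
theorem isCapitalClass_relative (α : ℕ → Bool) :
    IsCapitalClass fun H => ∃ G : OracleApprox, G.ComputesTotal α H where
  countable := by
    choose F hF using fun H : {H // ∃ G : OracleApprox, G.ComputesTotal α H} => H.2
    refine Function.Injective.countable (f := F) fun H H' h => Subtype.ext (funext fun x => ?_)
    obtain ⟨k, hk⟩ := hF H x
    obtain ⟨l, hl⟩ := hF H' x
    rw [← h] at hl
    have h1 := (F H).exists_bound (le_max_left k l) hk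
    have h2 := (F H).exists_bound (le_max_right k l) hl
    exact Option.some_inj.1 (h1.symm.trans h2)
  zero := ⟨⟨fun _ _ => some 0, Computable.const _, fun _ h => h⟩, fun _ => ⟨0, rfl⟩⟩
  lin := by
    rintro H H' a b ⟨G, hG⟩ ⟨G', hG'⟩
    have hG1 : Computable₂ fun (p : List Bool × ℕ) (_ : ℕ) => G'.toFun p.1 p.2 :=
      (G'.computable.comp (Computable.fst.comp Computable.fst)
        (Computable.snd.comp Computable.fst)).to₂
    have hlin : Computable₂ fun (p : (List Bool × ℕ) × ℕ) (v' : ℕ) => a * p.2 + b * v' :=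
      (Primrec.nat_add.to_comp.comp
        (Primrec.nat_mul.to_comp.comp (Computable.const a) (Computable.snd.comp Computable.fst))
        (Primrec.nat_mul.to_comp.comp (Computable.const b) Computable.snd)).to₂
    have hmap : Computable₂ fun (p : List Bool × ℕ) (v : ℕ) =>
        (G'.toFun p.1 p.2).map fun v' => a * v + b * v' :=
      Computable.option_map hG1 hlin
    refine ⟨⟨fun σ n => (G.toFun σ n).bind fun v => (G'.toFun σ n).map fun v' => a * v + b * v',
      Computable.option_bind G.computable hmap, ?_⟩, fun x => ?_⟩
    · intro σ σ' n v hσ hv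
      simp only [Option.bind_eq_some_iff, Option.map_eq_some_iff] at hv ⊢
      obtain ⟨c, hc, d, hd, rfl⟩ := hv
      exact ⟨c, G.mono hσ hc, d, G'.mono hσ hd, rfl⟩
    · obtain ⟨k, hk⟩ := hG x
      obtain ⟨l, hl⟩ := hG' x
      refine ⟨max k l, ?_⟩
      simp only [G.exists_bound (le_max_left k l) hk, G'.exists_bound (le_max_right k l) hl,
        Option.bind_some, Option.map_some]

theorem ComputableIn.computable_of_empty {A B : Type*} [Primcodable A] [Primcodable B] {q : A → B}
    (h : ComputableIn ∅ q) : Computable q :=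
  recursiveIn_empty_iff.1 h

theorem isCR_of_capital {α : ℕ → Bool} (h : ∀ H : List Bool → ℕ, Computable H → IsSuper H →
    BddAbove (Set.range fun k => capital H 1 (bitPrefix α k))) : IsCR α := by
  rintro f hf ⟨q, hq, hqf⟩
  have hq' := hq.computable_of_empty
  obtain ⟨hs, hle⟩ := hf.exists_capital (a := fun x => (q (x, x.length + 5)).1)
    (b := fun x => (q (x, x.length + 5)).2) fun x => hqf x (x.length + 5)
  refine BddAbove.range_mono _ (fun k => hle _) (h _ ?_ hs)
  have hx : Computable fun x : List Bool => q (x, x.length + 5) :=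
    hq'.comp (Computable.pair Computable.id
      (Primrec.nat_add.to_comp.comp Computable.list_length (Computable.const 5)))
  exact Primrec.nat_sub.to_comp.comp (Primrec.nat_add.to_comp.comp (Computable.fst.comp hx)
    (Computable.const 32)) (Computable.snd.comp hx)

theorem isCRRelativeTo_of_capital {α β : ℕ → Bool} (h : ∀ H : List Bool → ℕ,
    (∃ G : OracleApprox, G.ComputesTotal α H) → IsSuper H →
      BddAbove (Set.range fun k => capital H 1 (bitPrefix β k))) : IsCRRelativeTo β α := by
  rintro f hf ⟨q, hq, hqf⟩
  obtain ⟨hs, hle⟩ := hf.exists_capital (a := fun x => (q (x, x.length + 5)).1)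
    (b := fun x => (q (x, x.length + 5)).2) fun x => hqf x (x.length + 5)
  refine BddAbove.range_mono _ (fun k => hle _) (h _ ?_ hs)
  obtain ⟨G, hG⟩ := Nat.RecursiveIn.exists_computes hq
  have harg : Computable fun x : List Bool => Encodable.encode (x, x.length + 5) :=
    Computable.encode.comp (Computable.pair Computable.id
      (Primrec.nat_add.to_comp.comp Computable.list_length (Computable.const 5)))
  have hG1 : Computable fun p : (List Bool × ℕ) × List Bool =>
      G.toFun p.1.1 (Encodable.encode (p.2, p.2.length + 5)) :=
    G.computable.comp (Computable.fst.comp Computable.fst) (harg.comp Computable.snd)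
  have hval : Computable₂ fun (_ : ((List Bool × ℕ) × List Bool) × ℕ) (r : ℕ × ℕ) =>
      r.1 + 32 - r.2 :=
    (Primrec.nat_sub.to_comp.comp (Primrec.nat_add.to_comp.comp
      (Computable.fst.comp Computable.snd) (Computable.const 32))
      (Computable.snd.comp Computable.snd)).to₂
  have hdec : Computable fun p : ((List Bool × ℕ) × List Bool) × ℕ =>
      (Encodable.decode p.2 : Option (ℕ × ℕ)) :=
    Computable.decode.comp Computable.snd
  have hbind : Computable₂ fun (p : List Bool × ℕ) (x : List Bool) =>
      (G.toFun p.1 (Encodable.encode (x, x.length + 5))).bind fun c =>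
        (Encodable.decode c : Option (ℕ × ℕ)).map fun r => r.1 + 32 - r.2 :=
    Computable.option_bind hG1 (Computable.option_map hdec hval).to₂
  have hdec' : Computable fun p : List Bool × ℕ =>
      (Encodable.decode p.2 : Option (List Bool)) :=
    Computable.decode.comp Computable.snd
  refine ⟨⟨fun σ n => (Encodable.decode n : Option (List Bool)).bind fun x =>
    (G.toFun σ (Encodable.encode (x, x.length + 5))).bind fun c =>
      (Encodable.decode c : Option (ℕ × ℕ)).map fun r => r.1 + 32 - r.2,
    Computable.option_bind hdec' hbind, ?_⟩, fun x => ?_⟩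
  · intro σ σ' n v hσ hv
    simp only [Option.bind_eq_some_iff] at hv ⊢
    obtain ⟨x, hx, c, hc, hr⟩ := hv
    exact ⟨x, hx, c, G.mono hσ hc, hr⟩
  · obtain ⟨k, hk⟩ := (hG (Encodable.encode (x, x.length + 5))
      (Encodable.encode (q (x, x.length + 5)))).1 (by simp)
    exact ⟨k, by simp only [Encodable.encodek, Option.bind_some, hk, Option.map_some]⟩

/-! ### Halting stages -/

/-- The code with number `n`, run on input `0`, halts after exactly `t` further units of fuel. -/
def haltsAt (n t : ℕ) : Bool :=
  (Nat.Partrec.Code.evaln (t + 1) (Denumerable.ofNat Nat.Partrec.Code n) 0).isSome &&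
    !(Nat.Partrec.Code.evaln t (Denumerable.ofNat Nat.Partrec.Code n) 0).isSome

theorem primrec_evaln_isSome : Primrec₂ fun n t : ℕ =>
    (Nat.Partrec.Code.evaln t (Denumerable.ofNat Nat.Partrec.Code n) 0).isSome :=
  Primrec.option_isSome.comp (Nat.Partrec.Code.primrec_evaln.comp (Primrec.pair
    (Primrec.pair Primrec.snd ((Primrec.ofNat Nat.Partrec.Code).comp Primrec.fst))
    (Primrec.const 0)))

theorem computable₂_haltsAt : Computable₂ haltsAt := by
  have h : Primrec₂ haltsAt := Primrec.and.comp
    (primrec_evaln_isSome.comp Primrec.fst (Primrec.succ.comp Primrec.snd))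
    (Primrec.not.comp (primrec_evaln_isSome.comp Primrec.fst Primrec.snd))
  exact Primrec.to_comp h

theorem evaln_isSome_mono {s t n : ℕ} (hst : s ≤ t)
    (h : (Nat.Partrec.Code.evaln s (Denumerable.ofNat Nat.Partrec.Code n) 0).isSome = true) :
    (Nat.Partrec.Code.evaln t (Denumerable.ofNat Nat.Partrec.Code n) 0).isSome = true := by
  obtain ⟨v, hv⟩ := Option.isSome_iff_exists.1 h
  exact Option.isSome_iff_exists.2 ⟨v, Nat.Partrec.Code.evaln_mono hst hv⟩

theorem haltsAt_unique {n s t : ℕ} (hs : haltsAt n s = true) (ht : haltsAt n t = true) :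
    s = t := by
  simp only [haltsAt, Bool.and_eq_true, Bool.not_eq_true', Bool.eq_false_iff] at hs ht
  rcases lt_trichotomy s t with h | h | h
  · exact absurd (evaln_isSome_mono h hs.1) ht.2
  · exact h
  · exact absurd (evaln_isSome_mono h ht.1) hs.2

/-- Halting stages are not bounded by a computable function. -/
theorem exists_haltsAt_gt {u : ℕ → ℕ} (hu : Computable u) (n₀ : ℕ) :
    ∃ n ≥ n₀, ∃ t > u n, haltsAt n t = true := by
  by_contra! hcon
  -- The finitely many programs below `n₀` are covered by a constant, so that `u n + B` bounds every
  -- halting stage and halting becomes decidable.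
  obtain ⟨B, hB⟩ : ∃ B, ∀ n < n₀, ∀ t, haltsAt n t = true → t ≤ B := by
    clear hcon
    induction n₀ with
    | zero => exact ⟨0, by simp⟩
    | succ m ih =>
      obtain ⟨B, hB⟩ := ih
      by_cases h : ∃ t, haltsAt m t = true
      · obtain ⟨s, hs⟩ := h
        refine ⟨max B s, fun n hn t ht => ?_⟩
        rcases Nat.lt_succ_iff_lt_or_eq.1 hn with h1 | rfl
        · exact (hB n h1 t ht).trans (le_max_left _ _)
        · exact (haltsAt_unique ht hs).le.trans (le_max_right _ _)
      · refine ⟨B, fun n hn t ht => ?_⟩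
        rcases Nat.lt_succ_iff_lt_or_eq.1 hn with h1 | rfl
        · exact hB n h1 t ht
        · exact absurd ⟨t, ht⟩ h
  have hbd : ∀ n t, haltsAt n t = true → t ≤ u n + B := by
    intro n t ht
    by_cases hn : n < n₀
    · exact (hB n hn t ht).trans (Nat.le_add_left _ _)
    · by_contra h
      exact hcon n (not_lt.1 hn) t (by omega) ht
  have hdom : ∀ c : Nat.Partrec.Code, (c.eval 0).Dom ↔
      (Nat.Partrec.Code.evaln (u (Encodable.encode c) + B + 1)
        (Denumerable.ofNat Nat.Partrec.Code (Encodable.encode c)) 0).isSome = true := by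
    intro c
    constructor
    · intro h
      obtain ⟨k, hk⟩ := Nat.Partrec.Code.evaln_complete.1 (Part.get_mem h)
      have hex : ∃ k, (Nat.Partrec.Code.evaln k
          (Denumerable.ofNat Nat.Partrec.Code (Encodable.encode c)) 0).isSome = true :=
        ⟨k, Option.isSome_iff_exists.2 ⟨_, by rw [Denumerable.ofNat_encode]; exact hk⟩⟩
      classical
      have hfind := Nat.find_spec hex
      have hmin := fun m (hm : m < Nat.find hex) => Nat.find_min hex hm
      generalize Nat.find hex = m at hfind hmin
      rcases m with _ | m
      · simp [Nat.Partrec.Code.evaln] at hfind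
      · have h1 : haltsAt (Encodable.encode c) m = true := by
          have h2 := hmin m (Nat.lt_succ_self m)
          simp only [haltsAt, hfind, Bool.true_and, Bool.not_eq_true']
          exact Bool.eq_false_iff.2 h2
        exact evaln_isSome_mono (Nat.succ_le_succ (hbd _ _ h1)) hfind
    · intro h
      obtain ⟨v, hv⟩ := Option.isSome_iff_exists.1 h
      rw [Denumerable.ofNat_encode] at hv
      exact Part.dom_iff_mem.2 ⟨v, Nat.Partrec.Code.evaln_sound hv⟩
  refine ComputablePred.halting_problem 0 (ComputablePred.computable_iff.2
    ⟨fun c : Nat.Partrec.Code => (Nat.Partrec.Code.evaln (u (Encodable.encode c) + B + 1)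
        (Denumerable.ofNat Nat.Partrec.Code (Encodable.encode c)) 0).isSome, ?_,
      funext fun c => propext (hdom c)⟩)
  exact primrec_evaln_isSome.to_comp.comp Computable.encode
    (Computable.succ.comp (Primrec.nat_add.to_comp.comp (hu.comp Computable.encode)
      (Computable.const B)))

/-! ### Searching for conditions that decide an oracle computation -/

/-- All bitstrings of length at most `n`. -/
def stringsUpTo : ℕ → List (List Bool)
  | 0 => [[]]
  | n + 1 => [] :: (stringsUpTo n).flatMap fun x => [false :: x, true :: x]

theorem mem_stringsUpTo {n : ℕ} {x : List Bool} : x ∈ stringsUpTo n ↔ x.length ≤ n := by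
  induction n generalizing x with
  | zero => simp [stringsUpTo]
  | succ n ih =>
    rcases x with _ | ⟨b, x⟩
    · simp [stringsUpTo]
    · cases b <;> simp [stringsUpTo, ih]

theorem primrec_stringsUpTo : Primrec stringsUpTo := by
  have hstep : Primrec₂ fun (_ : ℕ) (l : List (List Bool)) =>
      [] :: l.flatMap fun x => [false :: x, true :: x] := by
    refine Primrec.list_cons.comp (Primrec.const []) (Primrec.list_flatMap Primrec.snd ?_)
    exact Primrec.list_cons.comp (Primrec.list_cons.comp (Primrec.const false) Primrec.snd)
      (Primrec.list_cons.comp (Primrec.list_cons.comp (Primrec.const true) Primrec.snd)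
        (Primrec.const []))
  refine (Primrec.nat_rec₁ [[]] hstep).of_eq fun n => ?_
  induction n with
  | zero => rfl
  | succ n ih => simp only [stringsUpTo, ← ih]

theorem Computable.exists_choice {T : ℕ → List Bool → Bool} (hT : Computable₂ T)
    (h : ∀ n, ∃ w, T n w = true) : ∃ f : ℕ → List Bool, Computable f ∧ ∀ n, T n (f n) = true := by
  have hdec : Computable fun m : ℕ => ((Encodable.decode m : Option (List Bool)).getD []) :=
    Computable.option_getD Computable.decode (Computable.const [])
  have hT' : Computable₂ fun n m : ℕ =>
      T n ((Encodable.decode m : Option (List Bool)).getD []) :=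
    hT.comp Computable.fst (hdec.comp Computable.snd)
  have hfind := Partrec.rfind hT'.partrec₂
  have hdom : ∀ n, (Nat.rfind fun m => Part.some
      (T n ((Encodable.decode m : Option (List Bool)).getD []))).Dom := by
    intro n
    obtain ⟨w, hw⟩ := h n
    exact Nat.rfind_dom.2 ⟨Encodable.encode w, by simp [hw], fun _ => trivial⟩
  let g : ℕ → ℕ := fun n => (Nat.rfind fun m => Part.some
      (T n ((Encodable.decode m : Option (List Bool)).getD []))).get (hdom n)
  have hg : Computable g := hfind.of_eq_tot fun n => Part.get_mem (hdom n)
  refine ⟨_, hdec.comp hg, fun n => ?_⟩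
  have h1 := Nat.rfind_spec (Part.get_mem (hdom n))
  exact (Part.mem_some_iff.1 h1).symm

namespace Cond

variable {C : (List Bool → ℕ) → Prop}

/-- Values once decided stay decided in stronger conditions, so the strings can be treated one after
another. -/
theorem exists_decides_list {G : OracleApprox} {p : Cond C}
    (h : ∀ q ≥ p, ∀ y : List Bool, ∃ r ≥ q, (G.toFun r.stem (Encodable.encode y)).isSome = true)
    (L : List (List Bool)) :
    ∃ r ≥ p, ∀ y ∈ L, (G.toFun r.stem (Encodable.encode y)).isSome = true := by
  induction L with
  | nil => exact ⟨p, le_rfl, by simp⟩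
  | cons y L ih =>
    obtain ⟨q, hq, hL⟩ := ih
    obtain ⟨r, hr, hy⟩ := h q hq y
    refine ⟨r, hq.trans hr, fun z hz => ?_⟩
    rcases List.mem_cons.1 hz with rfl | hz
    · exact hy
    · obtain ⟨v, hv⟩ := Option.isSome_iff_exists.1 (hL z hz)
      exact Option.isSome_iff_exists.2 ⟨v, G.mono hr.1 hv⟩

/-- The length of an extension deciding an oracle computation on all short strings can be found
computably. -/
theorem exists_computable_length {G : OracleApprox} {p : Cond Computable}
    (h : ∀ q ≥ p, ∀ y : List Bool, ∃ r ≥ q, (G.toFun r.stem (Encodable.encode y)).isSome = true) :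
    ∃ u : ℕ → ℕ, Computable u ∧ ∀ n, ∃ q ≥ p, q.stem.length = u n ∧
      ∀ y : List Bool, y.length ≤ 3 * n → (G.toFun q.stem (Encodable.encode y)).isSome = true := by
  obtain ⟨H, D, hH, -, hD, hcap⟩ := p.isCapital
  let T : ℕ → List Bool → Bool := fun n w =>
    decide (∀ k < w.length + 1, decide
      (H (p.stem ++ w.take k) < D * 2 ^ (p.stem ++ w.take k).length) = true) &&
    decide (∀ i < (stringsUpTo (3 * n)).length,
      ((stringsUpTo (3 * n))[i]?.bind fun y =>
        G.toFun (p.stem ++ w) (Encodable.encode y)).isSome = true)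
  have hTdef : ∀ n w, T n w = true ↔ (∀ w', w' <+: w → p.cap (p.stem ++ w') < 1) ∧
      ∀ y : List Bool, y.length ≤ 3 * n →
        (G.toFun (p.stem ++ w) (Encodable.encode y)).isSome = true := by
    intro n w
    simp only [T, Bool.and_eq_true, decide_eq_true_eq, hcap, capital_lt_iff hD]
    refine and_congr ⟨fun h1 w' hw' => ?_, fun h1 k hk => h1 _ (List.take_prefix _ _)⟩
      ⟨fun h1 y hy => ?_, fun h1 i hi => ?_⟩
    · have := h1 w'.length (Nat.lt_succ_of_le hw'.length_le)
      rwa [← List.prefix_iff_eq_take.1 hw'] at this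
    · obtain ⟨i, hi, rfl⟩ := List.mem_iff_getElem.1 (mem_stringsUpTo.2 hy)
      simpa [List.getElem?_eq_getElem hi] using h1 i hi
    · rw [List.getElem?_eq_getElem hi, Option.bind_some]
      exact h1 _ (mem_stringsUpTo.1 (List.getElem_mem hi))
  have hT : Computable₂ T := by
    have htake : Computable fun q : (ℕ × List Bool) × ℕ => p.stem ++ q.1.2.take q.2 :=
      Computable.list_append.comp (Computable.const _) (Primrec.list_take.to_comp.comp
        Computable.snd (Computable.snd.comp Computable.fst))
    have hbd : Computable fun q : (ℕ × List Bool) × ℕ =>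
        D * 2 ^ (p.stem ++ q.1.2.take q.2).length :=
      Primrec.nat_mul.to_comp.comp (Computable.const D) (Primrec.nat_pow.to_comp.comp
        (Computable.const 2) (Computable.list_length.comp htake))
    have hlt : Computable₂ fun a b : ℕ => decide (a < b) := Primrec.nat_lt.decide.to_comp
    have h1 : Computable fun q : ℕ × List Bool => decide (∀ k < q.2.length + 1, decide
        (H (p.stem ++ q.2.take k) < D * 2 ^ (p.stem ++ q.2.take k).length) = true) :=
      Computable.forall_lt (hlt.comp (hH.comp htake) hbd).to₂
        (Computable.succ.comp (Computable.list_length.comp Computable.snd))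
    have hstr : Computable fun q : ℕ × List Bool => stringsUpTo (3 * q.1) :=
      primrec_stringsUpTo.to_comp.comp
        (Primrec.nat_mul.to_comp.comp (Computable.const 3) Computable.fst)
    have hG : Computable₂ fun (q : (ℕ × List Bool) × ℕ) (y : List Bool) =>
        G.toFun (p.stem ++ q.1.2) (Encodable.encode y) :=
      (G.computable.comp (Computable.list_append.comp (Computable.const _)
        (Computable.snd.comp (Computable.fst.comp Computable.fst)))
        (Computable.encode.comp Computable.snd)).to₂
    have hbind : Computable₂ fun (q : ℕ × List Bool) (i : ℕ) =>
        ((stringsUpTo (3 * q.1))[i]?.bind fun y =>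
          G.toFun (p.stem ++ q.2) (Encodable.encode y)).isSome :=
      (Primrec.option_isSome.to_comp.comp (Computable.option_bind
        (Computable.list_getElem?.comp (hstr.comp Computable.fst) Computable.snd) hG)).to₂
    exact Primrec.and.to_comp.comp h1
      (Computable.forall_lt hbind (Computable.list_length.comp hstr))
  -- The search succeeds: a condition `r` deciding all the strings may have a larger capital than
  -- `p`, but the order keeps `p.cap` below `1` all the way to the stem of `r`.
  obtain ⟨f, hf, hfT⟩ := Computable.exists_choice hT fun n => by
    obtain ⟨r, hr, hy⟩ := exists_decides_list h (stringsUpTo (3 * n))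
    obtain ⟨w, hw⟩ := hr.1
    refine ⟨w, (hTdef n w).2 ⟨fun w' hw' => hr.2.1 _ (List.prefix_append _ _) ?_, fun y hl => ?_⟩⟩
    · rw [← hw]; exact (List.prefix_append_right_inj _).2 hw'
    · rw [hw]; exact hy y (mem_stringsUpTo.2 hl)
  refine ⟨fun n => p.stem.length + (f n).length, Primrec.nat_add.to_comp.comp
    (Computable.const _) (Computable.list_length.comp hf), fun n => ?_⟩
  obtain ⟨h1, h2⟩ := (hTdef n (f n)).1 (hfT n)
  exact ⟨p.append (f n) h1, p.le_append _ _, by simp [append], h2⟩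

/-- The conditions that force `G` not to compute a supermartingale with `capital τ < 1`, or that
provide a string `τ'` extending `τ` along which the capital stays below `1` and which contains at
position `n` a copy of the block of the stem at the halting stage of `n`. -/
def decided (G : OracleApprox) (D : ℕ) (τ : List Bool) (n₀ : ℕ) : Set (Cond C) :=
  {p | (∃ y : List Bool, ∀ q ≥ p, ¬ (G.toFun q.stem (Encodable.encode y)).isSome = true) ∨
    (∃ (y : List Bool) (a b c : ℕ), G.toFun p.stem (Encodable.encode y) = some a ∧
      G.toFun p.stem (Encodable.encode (y ++ [false])) = some b ∧
      G.toFun p.stem (Encodable.encode (y ++ [true])) = some c ∧ 4 * a < b + c) ∨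
    (∃ v, G.toFun p.stem (Encodable.encode τ) = some v ∧ D * 2 ^ τ.length ≤ v) ∨
    ∃ n ≥ n₀, ∃ t τ', haltsAt n t = true ∧ τ <+: τ' ∧ τ'.length = 3 * n ∧
      t + 2 * n ≤ p.stem.length ∧ (∀ i < 2 * n, p.stem[t + i]? = τ'[n + i]?) ∧
      ∀ y, τ <+: y → y <+: τ' →
        ∃ v, G.toFun p.stem (Encodable.encode y) = some v ∧ v < D * 2 ^ y.length}

/-- If no stronger condition satisfies one of the first three alternatives, then `G` behaves above
`p` like a total supermartingale with capital below `1` at `τ`, and the copied block of the last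
alternative can be built. -/
theorem isCofinal_decided (G : OracleApprox) {D : ℕ} (hD : 0 < D) (τ : List Bool) (n₀ : ℕ) :
    IsCofinal (decided (C := Computable) G D τ n₀) := by
  intro p
  by_contra hcon
  push Not at hcon
  have hdef : ∀ q ≥ p, ∀ y : List Bool, ∃ r ≥ q,
      (G.toFun r.stem (Encodable.encode y)).isSome = true := by
    intro q hq y
    by_contra! h
    exact hcon q (Or.inl ⟨y, fun r hr => h r hr⟩) hq
  have hsup : ∀ q ≥ p, ∀ (y : List Bool) (a b c : ℕ),
      G.toFun q.stem (Encodable.encode y) = some a →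
      G.toFun q.stem (Encodable.encode (y ++ [false])) = some b →
      G.toFun q.stem (Encodable.encode (y ++ [true])) = some c → b + c ≤ 4 * a := by
    intro q hq y a b c ha hb hc
    by_contra! h
    exact hcon q (Or.inr (Or.inl ⟨y, a, b, c, ha, hb, hc, h⟩)) hq
  obtain ⟨q₀, hq₀, hv₀⟩ := hdef p le_rfl τ
  obtain ⟨v₀, hv₀⟩ := Option.isSome_iff_exists.1 hv₀
  have hv₀D : v₀ < D * 2 ^ τ.length := by
    by_contra! h
    exact hcon q₀ (Or.inr (Or.inr (Or.inl ⟨v₀, hv₀, h⟩))) hq₀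
  -- the capital of `G` at `τ` and its weight
  obtain ⟨N₀, hN₀⟩ : ∃ N₀ : ℝ, N₀ = v₀ / (D * 2 ^ τ.length) := ⟨_, rfl⟩
  have hDpos : (0 : ℝ) < D := by exact_mod_cast hD
  have hN₀0 : 0 ≤ N₀ := by rw [hN₀]; positivity
  have hN₀1 : N₀ < 1 := by
    rw [hN₀, div_lt_one (by positivity)]
    exact_mod_cast hv₀D
  obtain ⟨l, hl0, hl1⟩ : ∃ l : ℝ, 0 < l ∧ q₀.cap q₀.stem + l * N₀ < 1 := by
    have := q₀.cap_lt
    exact ⟨(1 - q₀.cap q₀.stem) / 2, by linarith, by nlinarith⟩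
  -- an almost minimal value of the capital
  obtain ⟨I, hI⟩ : ∃ I, I = sInf {x | ∃ r ≥ q₀, x = q₀.cap r.stem} := ⟨_, rfl⟩
  have hbdd : BddBelow {x | ∃ r ≥ q₀, x = q₀.cap r.stem} :=
    ⟨0, by rintro _ ⟨r, -, rfl⟩; exact q₀.isCapital.nonneg _⟩
  have hIle : ∀ r ≥ q₀, I ≤ q₀.cap r.stem := fun r hr => hI ▸ csInf_le hbdd ⟨r, hr, rfl⟩
  -- A bound `ρ` on the capital of `q₀` below the first term will keep the capital of `G` under `1`,
  -- and below the second term that of the condition.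
  have hIlt : I < min (I + l * (1 - N₀)) (1 - l * N₀) := by
    refine lt_min ?_ ?_
    · have : 0 < l * (1 - N₀) := mul_pos hl0 (by linarith)
      linarith
    · have := hIle q₀ le_rfl
      linarith
  obtain ⟨_, ⟨r, hr, rfl⟩, hrlt⟩ := exists_lt_of_csInf_lt
    (⟨_, q₀, le_rfl, rfl⟩ : {x | ∃ r ≥ q₀, x = q₀.cap r.stem}.Nonempty) (hI ▸ hIlt)
  rw [← hI] at hrlt
  obtain ⟨ρ, hρ1, hρ2⟩ := exists_rat_btwn hrlt
  have hρ0 : (0 : ℝ) < ρ := (q₀.isCapital.nonneg _).trans_lt hρ1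
  obtain ⟨a, b, ha, hb, hab⟩ : ∃ a b : ℕ, 0 < a ∧ 0 < b ∧ (ρ : ℝ) = a / b := by
    have h0 : 0 < ρ := by exact_mod_cast hρ0
    have hnum := Rat.num_pos.2 h0
    refine ⟨ρ.num.toNat, ρ.den, by omega, ρ.pos, ?_⟩
    have h1 : ((ρ.num.toNat : ℤ) : ℝ) = (ρ.num : ℝ) := by rw [Int.toNat_of_nonneg hnum.le]
    rw [Int.cast_natCast] at h1
    rw [h1, ← Rat.cast_intCast, ← Rat.cast_natCast, ← Rat.cast_div, Rat.num_div_den]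
  obtain ⟨hρI, hρN⟩ := lt_min_iff.1 hρ2
  have ha' : (0 : ℝ) < a := by exact_mod_cast ha
  have hb' : (0 : ℝ) < b := by exact_mod_cast hb
  have hscale : ∀ x, q₀.cap x * b / a < 1 ↔ q₀.cap x < ρ := by
    intro x
    rw [div_lt_one ha', hab, lt_div_iff₀ hb']
  -- Dividing the capital by the rational `ρ = a / b` turns the constraint `< 1` into `< ρ`, so the
  -- search defining `u` only finds stems that are still almost minimal.
  let q₁ : Cond Computable := ⟨r.stem, fun x => q₀.cap x * b / a,
    q₀.isCapital.mul_div isCapitalClass_computable b ha, (hscale _).2 hρ1⟩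
  have hq₁ : q₀ ≤ q₁ := by
    refine ⟨hr.1, hr.2.1, fun x => ?_⟩
    change q₀.cap x ≤ q₀.cap x * b / a
    have hab1 : (a : ℝ) ≤ b := by
      have h1 : (ρ : ℝ) ≤ 1 := by have := mul_nonneg hl0.le hN₀0; linarith
      rwa [hab, div_le_one hb'] at h1
    rw [le_div_iff₀ ha']
    exact mul_le_mul_of_nonneg_left hab1 (q₀.isCapital.nonneg x)
  obtain ⟨u, hu, huq⟩ := exists_computable_length (G := G) (p := q₁)
    fun q hq y => hdef q (hq₀.trans (hq₁.trans hq)) y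
  -- As `t > u n`, the values of `G` on all strings of length at most `3 * n` are fixed before the
  -- block at `t` begins.
  obtain ⟨n, hn, t, ht, hnt⟩ := exists_haltsAt_gt hu (max n₀ τ.length)
  obtain ⟨q₂, hq₂, hlen, hdec⟩ := huq n
  have hnτ : τ.length ≤ n := (le_max_right _ _).trans hn
  have hq₂ρ : q₀.cap q₂.stem < ρ := (hscale _).1 (hq₂.2.1 _ hq₂.1 List.prefix_rfl)
  have hq₀₂ : q₀ ≤ q₂ := hq₁.trans hq₂
  -- the values computed by `G`
  obtain ⟨V, hV⟩ : ∃ V : List Bool → ℕ, ∀ y, y.length ≤ 3 * n →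
      G.toFun q₂.stem (Encodable.encode y) = some (V y) :=
    ⟨fun y => (G.toFun q₂.stem (Encodable.encode y)).getD 0, fun y hy => by
      obtain ⟨v, hv⟩ := Option.isSome_iff_exists.1 (hdec y hy)
      simp only [hv, Option.getD_some]⟩
  have hVτ : capital V D τ = N₀ := by
    have h1 := hV τ (by omega)
    rw [G.mono hq₀₂.1 hv₀, Option.some_inj] at h1
    rw [capital, hN₀, h1]
  have hVsup : ∀ y : List Bool, y.length < 3 * n →
      capital V D (y ++ [false]) + capital V D (y ++ [true]) ≤ 2 * capital V D y := by
    intro y hy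
    exact capital_average hD (hsup q₂ (hq₀.trans hq₀₂) y _ _ _ (hV y hy.le)
      (hV _ (by simp; omega)) (hV _ (by simp; omega)))
  -- extend `τ` to length `n`, and the stem to length `t`
  obtain ⟨w₁, hw₁, hle₁⟩ := exists_path_le (fun w => capital V D (τ ++ w)) (n - τ.length)
    fun w hw => by simpa using hVsup (τ ++ w) (by simp; omega)
  simp only [List.append_nil, hVτ] at hle₁
  obtain ⟨w₂, hw₂, hle₂⟩ := (weaken hq₀₂).exists_append (t - q₂.stem.length)
  let q₃ : Cond Computable := (weaken hq₀₂).append w₂ fun w' hw' =>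
    (hle₂ w' hw').trans_lt (weaken hq₀₂).cap_lt
  have hq₃ : q₀ ≤ q₃ := (le_weaken hq₀₂).trans ((weaken hq₀₂).le_append _ _)
  have hq₃len : q₃.stem.length = t := by
    change (q₂.stem ++ w₂).length = t
    simp [hw₂]
    omega
  have hq₃ρ : q₀.cap q₃.stem < ρ := (hle₂ w₂ List.prefix_rfl).trans_lt hq₂ρ
  -- extend both by a common block
  obtain ⟨w₃, hw₃, hle₃⟩ := exists_path_le
    (fun w => q₀.cap (q₃.stem ++ w) + l * capital V D (τ ++ w₁ ++ w)) (2 * n) fun w hw => by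
      have h1 := q₀.isCapital.average (q₃.stem ++ w)
      have h2 := hVsup (τ ++ w₁ ++ w) (by simp; omega)
      have h3 := mul_le_mul_of_nonneg_left h2 hl0.le
      simp only [List.append_assoc] at h1 h3 ⊢
      linarith
  have hle₃' : ∀ w', w' <+: w₃ →
      q₀.cap (q₃.stem ++ w') + l * capital V D (τ ++ w₁ ++ w') < ρ + l * N₀ := by
    intro w' hw'
    have h1 := hle₃ w' hw'
    simp only [List.append_nil] at h1
    have h2 := mul_le_mul_of_nonneg_left (hle₁ w₁ List.prefix_rfl) hl0.le
    linarith
  have hcap₃ : ∀ w', w' <+: w₃ → q₃.cap (q₃.stem ++ w') < 1 := by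
    intro w' hw'
    have h1 := hle₃' w' hw'
    have h2 := mul_nonneg hl0.le (capital_nonneg V D (τ ++ w₁ ++ w'))
    change q₀.cap (q₃.stem ++ w') < 1
    linarith
  -- The capital of the condition cannot drop below `I`, so it cannot make room for the capital of
  -- `G` to reach `1`.
  have hcapV : ∀ w', w' <+: w₃ → capital V D (τ ++ w₁ ++ w') < 1 := by
    intro w' hw'
    have h1 := hle₃' w' hw'
    have h2 : I ≤ q₀.cap (q₃.stem ++ w') :=
      hIle (q₃.append w' fun w'' h => hcap₃ w'' (h.trans hw')) (hq₃.trans (q₃.le_append _ _))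
    have h3 : l * capital V D (τ ++ w₁ ++ w') < l * 1 := by linarith
    exact lt_of_mul_lt_mul_left h3 hl0.le
  have hq₄ : q₀ ≤ q₃.append w₃ hcap₃ := hq₃.trans (q₃.le_append _ _)
  have hstem : q₂.stem <+: (q₃.append w₃ hcap₃).stem :=
    (List.prefix_append _ _).trans (List.prefix_append _ _)
  have hτ₁ : (τ ++ w₁).length = n := by simp [hw₁]; omega
  refine hcon (q₃.append w₃ hcap₃) (Or.inr (Or.inr (Or.inr ⟨n, (le_max_left _ _).trans hn, t,
    τ ++ w₁ ++ w₃, hnt, ?_, ?_, ?_, fun i hi => ?_, fun y hy hy' => ?_⟩))) (hq₀.trans hq₄)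
  · rw [List.append_assoc]; exact List.prefix_append _ _
  · rw [List.length_append, hτ₁, hw₃]; omega
  · change _ ≤ (q₃.stem ++ w₃).length
    rw [List.length_append, hq₃len, hw₃]
  · change (q₃.stem ++ w₃)[t + i]? = _
    rw [List.getElem?_append_right (by omega), List.getElem?_append_right (by omega), hq₃len, hτ₁]
    simp
  · have hyl : y.length ≤ 3 * n := by
      have := hy'.length_le
      rw [List.length_append, hτ₁, hw₃] at this
      omega
    refine ⟨V y, G.mono hstem (hV y hyl), (capital_lt_iff hD y).1 ?_⟩
    rcases List.prefix_or_prefix_of_prefix hy' (List.prefix_append (τ ++ w₁) w₃) with h | h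
    · obtain ⟨w', rfl⟩ := hy
      exact (hle₁ w' ((List.prefix_append_right_inj _).1 h)).trans_lt hN₀1
    · obtain ⟨w', rfl⟩ := h
      exact hcapV w' ((List.prefix_append_right_inj _).1 hy')

end Cond

/-! ### A bivariate martingale betting on copied blocks -/

/-- The factor won by betting that two bits are equal, where missing bits do not count. -/
def matchWeight : Option Bool → Option Bool → ℕ
  | some u, some v => if u = v then 2 else 0
  | _, _ => 1

/-- The factor won by betting that bit `a` of `x` equals bit `b` of `y`. -/
def matchFactor (x y : List Bool) (a b : ℕ) : ℕ :=
  matchWeight x[a]? y[b]?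

theorem matchFactor_comm (x y : List Bool) (a b : ℕ) :
    matchFactor x y a b = matchFactor y x b a := by
  unfold matchFactor
  rcases x[a]? with _ | u <;> rcases y[b]? with _ | v <;> simp [matchWeight, eq_comm]

theorem matchFactor_of_length_le {x : List Bool} {a : ℕ} (h : x.length ≤ a) (y : List Bool)
    (b : ℕ) : matchFactor x y a b = 1 := by
  simp [matchFactor, matchWeight, List.getElem?_eq_none h]

theorem matchFactor_concat_of_ne {x : List Bool} {a : ℕ} (h : a ≠ x.length) (c : Bool)
    (y : List Bool) (b : ℕ) : matchFactor (x ++ [c]) y a b = matchFactor x y a b := by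
  have : (x ++ [c])[a]? = x[a]? := by
    rcases lt_or_gt_of_ne h with h | h
    · rw [List.getElem?_append_left h]
    · rw [List.getElem?_eq_none (by simp; omega), List.getElem?_eq_none h.le]
  simp [matchFactor, this]

theorem matchFactor_concat_length (x y : List Bool) (b : ℕ) :
    matchFactor (x ++ [false]) y x.length b + matchFactor (x ++ [true]) y x.length b = 2 := by
  unfold matchFactor
  rcases y[b]? with _ | _ | _ <;> simp [matchWeight]

/-- The capital obtained by betting that `m` bits of `x` starting at `a` are those of `y` starting
at `b`. -/
def matchProd (x y : List Bool) (a b m : ℕ) : ℕ :=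
  ∏ i ∈ Finset.range m, matchFactor x y (a + i) (b + i)

theorem matchProd_comm (x y : List Bool) (a b m : ℕ) :
    matchProd x y a b m = matchProd y x b a m :=
  Finset.prod_congr rfl fun _ _ => matchFactor_comm _ _ _ _

theorem matchProd_of_length_le {x : List Bool} {a : ℕ} (h : x.length ≤ a) (y : List Bool)
    (b m : ℕ) : matchProd x y a b m = 1 :=
  Finset.prod_eq_one fun _ _ => matchFactor_of_length_le (by omega) _ _

/-- The positions `a + i` are distinct, so a new bit of `x` affects at most one factor, and that
factor was `1` before. -/
theorem matchProd_average (x y : List Bool) (a b m : ℕ) :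
    matchProd (x ++ [false]) y a b m + matchProd (x ++ [true]) y a b m =
      2 * matchProd x y a b m := by
  induction m with
  | zero => simp [matchProd]
  | succ m ih =>
    simp only [matchProd, Finset.prod_range_succ] at ih ⊢
    by_cases h : a + m = x.length
    · have hprod : ∀ c, ∏ i ∈ Finset.range m, matchFactor (x ++ [c]) y (a + i) (b + i) =
          ∏ i ∈ Finset.range m, matchFactor x y (a + i) (b + i) := fun c =>
        Finset.prod_congr rfl fun i hi => matchFactor_concat_of_ne
          (by have := Finset.mem_range.1 hi; omega) _ _ _
      rw [hprod, hprod, ← mul_add, h, matchFactor_concat_length, matchFactor_of_length_le le_rfl]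
      ring
    · rw [matchFactor_concat_of_ne h, matchFactor_concat_of_ne h, ← add_mul, ih]
      ring

/-- The capital obtained by betting that the block of `x` at the halting stage of `n` is the block
of `y` at position `n`. -/
def blockBet (x y : List Bool) (n : ℕ) : ℕ :=
  ∏ t ∈ Finset.range x.length, if haltsAt n t = true then matchProd x y t n (2 * n) else 1

/-- Restricting to stages below `|x|` loses nothing, since a later block has no bits in `x` yet.
This makes the bet computable although halting is not. -/
theorem blockBet_of_haltsAt {n t : ℕ} (h : haltsAt n t = true) (x y : List Bool) :
    blockBet x y n = matchProd x y t n (2 * n) := by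
  by_cases ht : t < x.length
  · rw [blockBet, Finset.prod_eq_single t]
    · rw [if_pos h]
    · exact fun s _ hs => if_neg fun hh => hs (haltsAt_unique hh h)
    · exact fun hn => absurd (Finset.mem_range.2 ht) hn
  · rw [matchProd_of_length_le (not_lt.1 ht)]
    refine Finset.prod_eq_one fun s hs => if_neg fun hh => ?_
    rw [haltsAt_unique hh h] at hs
    exact ht (Finset.mem_range.1 hs)

theorem blockBet_of_not_haltsAt {n : ℕ} (h : ¬ ∃ t, haltsAt n t = true) (x y : List Bool) :
    blockBet x y n = 1 :=
  Finset.prod_eq_one fun t _ => if_neg fun ht => h ⟨t, ht⟩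

theorem blockBet_average_left (x y : List Bool) (n : ℕ) :
    blockBet (x ++ [false]) y n + blockBet (x ++ [true]) y n = 2 * blockBet x y n := by
  by_cases h : ∃ t, haltsAt n t = true
  · obtain ⟨t, ht⟩ := h
    simp only [blockBet_of_haltsAt ht, matchProd_average]
  · simp only [blockBet_of_not_haltsAt h]

theorem blockBet_average_right (x y : List Bool) (n : ℕ) :
    blockBet x (y ++ [false]) n + blockBet x (y ++ [true]) n = 2 * blockBet x y n := by
  by_cases h : ∃ t, haltsAt n t = true
  · obtain ⟨t, ht⟩ := h
    simp only [blockBet_of_haltsAt ht, matchProd_comm x, matchProd_average]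
  · simp only [blockBet_of_not_haltsAt h]

theorem blockBet_length (x y : List Bool) : blockBet x y y.length = 1 := by
  by_cases h : ∃ t, haltsAt y.length t = true
  · obtain ⟨t, ht⟩ := h
    rw [blockBet_of_haltsAt ht, matchProd_comm, matchProd_of_length_le le_rfl]
  · exact blockBet_of_not_haltsAt h x y

/-- The weighted sum of all block bets, multiplied by `2 ^ |y|`. -/
def copyNumerator (x y : List Bool) : ℕ :=
  ∑ n ∈ Finset.range y.length, 2 ^ (y.length - n) * blockBet x y n + 2

theorem copyNumerator_average_left (x y : List Bool) :
    copyNumerator (x ++ [false]) y + copyNumerator (x ++ [true]) y = 2 * copyNumerator x y := by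
  have h : ∑ n ∈ Finset.range y.length, 2 ^ (y.length - n) * blockBet (x ++ [false]) y n +
      ∑ n ∈ Finset.range y.length, 2 ^ (y.length - n) * blockBet (x ++ [true]) y n =
      2 * ∑ n ∈ Finset.range y.length, 2 ^ (y.length - n) * blockBet x y n := by
    rw [← Finset.sum_add_distrib, Finset.mul_sum]
    refine Finset.sum_congr rfl fun n _ => ?_
    rw [← mul_add, blockBet_average_left]
    ring
  unfold copyNumerator
  omega

/-- Bets with `n ≥ |y|` still equal `1` and have total weight `2 * 2 ^ (-|y|)`, which is the summand
`2` of the numerator. When `y` grows, the bet with `n = |y|` moves from this tail into the sum. -/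
theorem copyNumerator_average_right (x y : List Bool) :
    copyNumerator x (y ++ [false]) + copyNumerator x (y ++ [true]) = 4 * copyNumerator x y := by
  have h : ∑ n ∈ Finset.range (y.length + 1),
        2 ^ (y.length + 1 - n) * blockBet x (y ++ [false]) n +
      ∑ n ∈ Finset.range (y.length + 1), 2 ^ (y.length + 1 - n) * blockBet x (y ++ [true]) n =
      4 * ∑ n ∈ Finset.range y.length, 2 ^ (y.length - n) * blockBet x y n + 4 := by
    rw [← Finset.sum_add_distrib, Finset.sum_range_succ, ← mul_add, blockBet_average_right,
      blockBet_length, Finset.mul_sum]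
    congr 1
    · refine Finset.sum_congr rfl fun n hn => ?_
      have hn := Finset.mem_range.1 hn
      rw [← mul_add, blockBet_average_right, Nat.succ_sub hn.le, pow_succ]
      ring
    · simp
  simp only [copyNumerator, List.length_append, List.length_singleton]
  omega

/-- The bivariate martingale betting on all copied blocks. -/
noncomputable def copyMartingale (x y : List Bool) : ℝ :=
  copyNumerator x y / 2 ^ y.length

theorem isBivariateMartingale_copyMartingale : IsBivariateMartingale copyMartingale := by
  refine ⟨fun x => ⟨fun y => by unfold copyMartingale; positivity, fun y => ?_⟩,
    fun y => ⟨fun x => by unfold copyMartingale; positivity, fun x => ?_⟩⟩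
  · have h : (copyNumerator x (y ++ [false]) : ℝ) + copyNumerator x (y ++ [true]) =
        4 * copyNumerator x y := by exact_mod_cast copyNumerator_average_right x y
    simp only [copyMartingale, List.length_append, List.length_singleton]
    rw [← add_div, h, pow_succ]
    field_simp
    norm_num
  · have h : (copyNumerator (x ++ [false]) y : ℝ) + copyNumerator (x ++ [true]) y =
        2 * copyNumerator x y := by exact_mod_cast copyNumerator_average_left x y
    simp only [copyMartingale]
    rw [← add_div, h]
    field_simp

theorem computable_matchFactor : Computable fun p : (List Bool × List Bool) × ℕ × ℕ =>
    matchFactor p.1.1 p.1.2 p.2.1 p.2.2 := by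
  have h : Primrec fun o : Option Bool × Option Bool => matchWeight o.1 o.2 := Primrec.dom_finite _
  exact (h.comp (Primrec.pair
    (Primrec.list_getElem?.comp (Primrec.fst.comp Primrec.fst) (Primrec.fst.comp Primrec.snd))
    (Primrec.list_getElem?.comp (Primrec.snd.comp Primrec.fst)
      (Primrec.snd.comp Primrec.snd)))).to_comp

theorem computable_blockBet : Computable fun p : (List Bool × List Bool) × ℕ =>
    blockBet p.1.1 p.1.2 p.2 := by
  have hfac : Computable₂ fun (p : ((List Bool × List Bool) × ℕ) × ℕ) (i : ℕ) =>
      matchFactor p.1.1.1 p.1.1.2 (p.2 + i) (p.1.2 + i) :=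
    (computable_matchFactor.comp (Computable.pair
      (Computable.fst.comp (Computable.fst.comp Computable.fst))
      (Computable.pair
        (Primrec.nat_add.to_comp.comp (Computable.snd.comp Computable.fst) Computable.snd)
        (Primrec.nat_add.to_comp.comp
          (Computable.snd.comp (Computable.fst.comp Computable.fst)) Computable.snd)))).to₂
  have hprod : Computable fun p : ((List Bool × List Bool) × ℕ) × ℕ =>
      matchProd p.1.1.1 p.1.1.2 p.2 p.1.2 (2 * p.1.2) :=
    Computable.prod_range hfac (Primrec.nat_mul.to_comp.comp (Computable.const 2)
      (Computable.snd.comp Computable.fst))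
  have hcond : Computable₂ fun (p : (List Bool × List Bool) × ℕ) (t : ℕ) =>
      bif haltsAt p.2 t then matchProd p.1.1 p.1.2 t p.2 (2 * p.2) else 1 :=
    Computable.cond (computable₂_haltsAt.comp (Computable.snd.comp Computable.fst) Computable.snd)
      hprod (Computable.const 1)
  refine (Computable.prod_range hcond (Computable.list_length.comp
    (Computable.fst.comp Computable.fst))).of_eq fun p => ?_
  simp only [blockBet, Bool.cond_eq_ite]

theorem computable_copyNumerator : Computable fun p : List Bool × List Bool =>
    copyNumerator p.1 p.2 := by
  have hlen : Computable fun p : List Bool × List Bool => p.2.length :=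
    Computable.list_length.comp Computable.snd
  have hterm : Computable₂ fun (p : List Bool × List Bool) (n : ℕ) =>
      2 ^ (p.2.length - n) * blockBet p.1 p.2 n :=
    (Primrec.nat_mul.to_comp.comp (Primrec.nat_pow.to_comp.comp (Computable.const 2)
      (Primrec.nat_sub.to_comp.comp (hlen.comp Computable.fst) Computable.snd))
      computable_blockBet).to₂
  exact Primrec.nat_add.to_comp.comp (Computable.sum_range hterm hlen) (Computable.const 2)

theorem realComputable_copyMartingale :
    RealComputable fun p : List Bool × List Bool => copyMartingale p.1 p.2 := by
  refine ⟨fun r => (copyNumerator r.1.1 r.1.2 * 2 ^ r.2 / 2 ^ r.1.2.length, 0),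
    Computable.computableIn ?_, fun p n => ?_⟩
  · have hlen : Computable fun r : (List Bool × List Bool) × ℕ => r.1.2.length :=
      Computable.list_length.comp (Computable.snd.comp Computable.fst)
    exact Computable.pair (Primrec.nat_div.to_comp.comp
      (Primrec.nat_mul.to_comp.comp (computable_copyNumerator.comp Computable.fst)
        (Primrec.nat_pow.to_comp.comp (Computable.const 2) Computable.snd))
      (Primrec.nat_pow.to_comp.comp (Computable.const 2) hlen)) (Computable.const 0)
  · simp only [copyMartingale]
    generalize copyNumerator p.1 p.2 = N
    generalize p.2.length = k
    have hk : (0 : ℝ) < 2 ^ k := by positivity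
    have hn : (0 : ℝ) < 2 ^ n := by positivity
    have h1 : ((N * 2 ^ n / 2 ^ k : ℕ) : ℝ) * 2 ^ k ≤ N * 2 ^ n := by
      exact_mod_cast Nat.div_mul_le_self (N * 2 ^ n) (2 ^ k)
    have h2 : (N : ℝ) * 2 ^ n < ((N * 2 ^ n / 2 ^ k : ℕ) + 1) * 2 ^ k := by
      have h3 := Nat.lt_mul_div_succ (N * 2 ^ n) (by positivity : 0 < 2 ^ k)
      rw [mul_comm (2 ^ k)] at h3
      exact_mod_cast h3
    generalize ((N * 2 ^ n / 2 ^ k : ℕ) : ℝ) = Q at h1 h2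
    have e : (N : ℝ) / 2 ^ k - (Q - ((0 : ℕ) : ℝ)) / 2 ^ n =
        (N * 2 ^ n - Q * 2 ^ k) / 2 ^ k / 2 ^ n := by
      field_simp
      simp
    rw [e, abs_div, abs_of_pos hn, div_le_div_iff_of_pos_right hn, abs_div, abs_of_pos hk,
      div_le_one hk, abs_le]
    constructor <;> nlinarith

/-- The sequence `β` contains at position `n` a copy of the block of `α` at the halting stage of
`n`. -/
def CopiesAt (α β : ℕ → Bool) (n : ℕ) : Prop :=
  ∃ t, haltsAt n t = true ∧ ∀ i < 2 * n, α (t + i) = β (n + i)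

theorem two_pow_le_copyMartingale {α β : ℕ → Bool} {n : ℕ} (h : CopiesAt α β n) :
    ∃ k, 2 ^ n ≤ copyMartingale (bitPrefix α k) (bitPrefix β k) := by
  obtain ⟨t, ht, hab⟩ := h
  -- Prefixes of this length contain both blocks, and the weight `2 ^ (k - n)` of the bet occurs in
  -- the sum.
  refine ⟨t + 3 * n + 1, ?_⟩
  have hbet : blockBet (bitPrefix α (t + 3 * n + 1)) (bitPrefix β (t + 3 * n + 1)) n =
      2 ^ (2 * n) := by
    rw [blockBet_of_haltsAt ht, matchProd, Finset.prod_congr rfl (g := fun _ => 2),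
      Finset.prod_const, Finset.card_range]
    intro i hi
    have hi := Finset.mem_range.1 hi
    rw [matchFactor, bitPrefix_getElem? α (by omega), bitPrefix_getElem? β (by omega)]
    simp [matchWeight, hab i hi]
  have hle : 2 ^ n * 2 ^ (t + 3 * n + 1) ≤
      copyNumerator (bitPrefix α (t + 3 * n + 1)) (bitPrefix β (t + 3 * n + 1)) := by
    rw [copyNumerator, bitPrefix_length]
    refine le_trans ?_ ((Finset.single_le_sum (f := fun m => 2 ^ (t + 3 * n + 1 - m) *
      blockBet (bitPrefix α (t + 3 * n + 1)) (bitPrefix β (t + 3 * n + 1)) m)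
      (fun _ _ => Nat.zero_le _) (Finset.mem_range.2 (by omega : n < t + 3 * n + 1))).trans
      (Nat.le_add_right _ _))
    simp only [hbet, ← pow_add]
    exact Nat.pow_le_pow_right (by norm_num) (by omega)
  rw [copyMartingale, bitPrefix_length, le_div_iff₀ (by positivity)]
  exact_mod_cast hle

theorem not_isCRPair_of_copiesAt {α β : ℕ → Bool} (h : ∀ n₀, ∃ n ≥ n₀, CopiesAt α β n) :
    ¬ IsCRPair α β := by
  intro hcr
  obtain ⟨B, hB⟩ := hcr _ isBivariateMartingale_copyMartingale realComputable_copyMartingale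
  obtain ⟨n₀, hn₀⟩ := pow_unbounded_of_one_lt B (one_lt_two : (1 : ℝ) < 2)
  obtain ⟨n, hn, hc⟩ := h n₀
  obtain ⟨k, hk⟩ := two_pow_le_copyMartingale hc
  have h1 := hB ⟨(k, k), rfl⟩
  have h2 : (2 : ℝ) ^ n₀ ≤ 2 ^ n := pow_le_pow_right₀ one_le_two hn
  simp only at h1
  linarith

/-! ### The pair of sequences -/

namespace Cond

/-- The conditions whose stem contains a copy of a block of `α` at the halting stage of some number
that is at least `n₀`. -/
def copying {C : (List Bool → ℕ) → Prop} (α : ℕ → Bool) (n₀ : ℕ) : Set (Cond C) :=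
  {q | ∃ n ≥ n₀, ∃ t, haltsAt n t = true ∧ ∀ i < 2 * n, some (α (t + i)) = q.stem[n + i]?}

/-- The capital of `q` has a name `G`, and `α` satisfies a condition deciding `G` at the stem of
`q`; the string `τ'` supplied there is the new stem. -/
theorem isCofinal_copying {α : ℕ → Bool}
    (hα : ∀ (G : OracleApprox) (D : ℕ) (τ : List Bool) (n₀ : ℕ), 0 < D →
      ∃ p : Cond Computable, p ∈ decided G D τ n₀ ∧ p.Below α) (n₀ : ℕ) :
    IsCofinal (copying (C := fun H => ∃ G : OracleApprox, G.ComputesTotal α H) α n₀) := by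
  intro q
  obtain ⟨V, D, ⟨G, hG⟩, hV, hD, hcap⟩ := q.isCapital
  obtain ⟨p, hp, hpα⟩ := hα G D q.stem n₀ hD
  have hval : ∀ (y : List Bool) (v : ℕ),
      G.toFun p.stem (Encodable.encode y) = some v → v = V y := by
    intro y v hv
    obtain ⟨k, hk⟩ := hG y
    rw [hpα.1] at hv
    have h1 := G.exists_bound (le_max_left k p.stem.length) hk
    have h2 := G.exists_bound (le_max_right k p.stem.length) hv
    exact Option.some_inj.1 (h2.symm.trans h1)
  -- The first three alternatives contradict, in turn, the totality of `V`, its supermartingale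
  -- property and the bound at the stem of `q`.
  rcases hp with ⟨y, hy⟩ | ⟨y, a, b, c, ha, hb, hc, habc⟩ | ⟨v, hv, hle⟩ |
    ⟨n, hn, t, τ', ht, hτ, hτl, hlen, hcopy, hτV⟩
  · obtain ⟨k, hk⟩ := hG y
    refine absurd ?_ (hy _ (hpα.le_extend (le_max_right k p.stem.length)))
    exact Option.isSome_iff_exists.2 ⟨_, G.exists_bound (le_max_left k p.stem.length) hk⟩
  · rw [hval _ _ ha, hval _ _ hb, hval _ _ hc] at habc
    exact absurd (hV y) (not_le.2 habc)
  · rw [hval _ _ hv] at hle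
    have h1 := q.cap_lt
    rw [hcap, capital_lt_iff hD] at h1
    exact absurd h1 (not_lt.2 hle)
  · have hlt : ∀ y, q.stem <+: y → y <+: τ' → q.cap y < 1 := by
      intro y h1 h2
      obtain ⟨v, hv, hlt⟩ := hτV y h1 h2
      rw [hcap, capital_lt_iff hD, ← hval y v hv]
      exact hlt
    refine ⟨⟨τ', q.cap, q.isCapital, hlt τ' hτ List.prefix_rfl⟩,
      ⟨n, hn, t, ht, fun i hi => ?_⟩, hτ, hlt, fun _ => le_rfl⟩
    rw [← hcopy i hi, hpα.1, bitPrefix_getElem? α (by omega)]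

end Cond

theorem proposition2 :
    ∃ α β : ℕ → Bool, ¬ IsCRPair α β ∧ IsCR α ∧ IsCRRelativeTo β α := by
  -- The shift by one in the second component makes every denominator positive.
  obtain ⟨α, hα, hdec⟩ := Cond.exists_generic isCapitalClass_computable
    (fun i : OracleApprox × ℕ × List Bool × ℕ =>
      Cond.decided i.1 (i.2.1 + 1) i.2.2.1 i.2.2.2)
    fun i => Cond.isCofinal_decided i.1 (Nat.succ_pos _) i.2.2.1 i.2.2.2
  obtain ⟨β, hβ, hcopy⟩ := Cond.exists_generic (isCapitalClass_relative α)
    (fun n₀ : ℕ => Cond.copying α n₀) (Cond.isCofinal_copying fun G D τ n₀ hD => by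
      have := hdec (G, D - 1, τ, n₀)
      rwa [Nat.sub_add_cancel hD] at this)
  refine ⟨α, β, not_isCRPair_of_copiesAt fun n₀ => ?_, isCR_of_capital hα,
    isCRRelativeTo_of_capital hβ⟩
  obtain ⟨q, ⟨n, hn, t, ht, hq⟩, hqβ⟩ := hcopy n₀
  refine ⟨n, hn, t, ht, fun i hi => ?_⟩
  have h1 := hq i hi
  have h2 : n + i < q.stem.length := (List.getElem?_eq_some_iff.1 h1.symm).1
  rw [hqβ.1, bitPrefix_getElem? β h2, Option.some_inj] at h1
  exact h1
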